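/- **Setting.** There are outcomes $0,1,\dots,m$ with values $0=v(0)\le v(1)\le\dots\le v(m)\le 1$ known to the requester; $0$ is the null outcome. A worker type $\theta$ consists of a cost function $c_\theta(e)$ and a production function $f_\theta(\cdot\,|\,e)$ (a distribution over outcomes for each effort level $e$). There is a null effort level, which has zero cost, leads to outcome $0$ with probability one, and is the only effort level that can lead to outcome $0$. In each round a worker arrives whose type is an independent sample from a fixed unknown supply distribution. If offered a contract $x$ (payment $x(\pi)$ for outcome $\pi$, $x(0)=0$), she chooses an effort level that maximizes her expected payment minus cost; then an outcome is drawn from her production function, and the requester observes only the outcome. Ties are broken consistently: a worker who is indifferent between the same two optimal effort levels under two contracts does not choose one of them under the first contract and the other one under the second. Let $F_\theta(\pi|e)=\sum_{\pi'\ge\pi}f_\theta(\pi'|e)$. All types satisfy first-order stochastic dominance (FOSD): for any two distinct effort levels, one of them, say $e$, satisfies $F_\theta(\pi|e)\ge F_\theta(\pi|e')$ for all $\pi$, with strict inequality for some $\pi$, where $e'$ is the other one. For a contract $x$, let $V(x)$ and $P(x)$ be the expected value and the expected payment in one round, and $U(x)=V(x)-P(x)$. A monotone contract is identified with its vector of increments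 $x(\pi)-x(\pi-1)\ge 0$, $\pi=1,\dots,m$. Let $X$ be the set of monotone contracts with payments in $[0,1]$, and let $X_{cand}\subset X$ be a non-empty set of candidate contracts. Put $\mathrm{OPT}=\sup_{x\in X_{cand}}U(x)$ and $X_\epsilon=\{x\in X_{cand}:\ \mathrm{OPT}-U(x)\le\epsilon\}$. **Cells.** A cell is a closed axis-aligned cube in the increment space $[0,1]^m$. It is relevant if it contains at least one candidate contract; a relevant cell is atomic if it contains exactly one and composite otherwise. The quadrants of a cell are its $2^m$ sub-cubes of half the side that have its center as a corner. The anchors of a composite cell $C$ are its maximal corner $x^+$ and its minimal corner $x^-$; the anchor of an atomic cell is its unique candidate contract. The virtual width is $\mathrm{vw}(C)=(V(x^+)-P(x^-))-(V(x^-)-P(x^+))$. The cell $[0,1]^m$ is feasible, and so is every relevant quadrant of a feasible cell. For $Y\subset X_{cand}$, $N_\epsilon(Y|X_{cand})$ is the number (possibly infinite) of feasible composite cells $C$ with $\mathrm{vw}(C)\ge\epsilon$ and $C\cap Y\neq\emptyset$. **Agnostic Zooming** (with time horizon $T$ and a constant $c\ge 16$). Initially the only active cell is $[0,1]^m$. In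 each round choose an active cell $C$ of maximal index (ties broken arbitrarily), post a contract drawn uniformly at random among the anchors of $C$, and observe the outcome. For a cell $C$ that has been chosen $n\ge1$ times so far, let $\mathrm{rad}(C)=\sqrt{c\log T/n}$, let $\bar U(C)$ be the average utility in these $n$ rounds, and, for composite $C$, let $\bar V^\pm(C),\bar P^\pm(C)$ be the average value and payment in those of these rounds in which $x^\pm$ was posted ($0$ if there are none), and $W(C)=(\bar V^+-\bar P^-)-(\bar V^--\bar P^+)$. The index of $C$ is $\bar U(C)+\mathrm{rad}(C)$ if $C$ is atomic, and $\bar U(C)+W(C)+5\,\mathrm{rad}(C)$ if $C$ is composite; it is $+\infty$ if $C$ has never been chosen. If after the round the chosen cell $C$ is composite and $W(C)>5\,\mathrm{rad}(C)$ (with the updated statistics), then $C$ is replaced in the set of active cells by its relevant quadrants. The regret $R(T|X_{cand})$ is $T\cdot\mathrm{OPT}$ minus the expected total utility of the requester over $T$ rounds. **Theorem.** There is an absolute constant $\beta_0>0$ such that for every $m$ and every $c\ge16$ there is a constant $K>0$, depending only on $m$ and $c$, such that for every problem instance as above, every non-empty $X_{cand}\subset X$, every $T\ge\max(2^m+1,18)$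 and every $\delta>0$, Agnostic Zooming satisfies $$R(T|X_{cand})\ \le\ \delta T+K\log T\sum_{\epsilon=2^{-j}\ge\delta,\ j\in\mathbb Z}\frac{N_{\epsilon\beta_0}(X_\epsilon|X_{cand})}{\epsilon}.$$ -/

import Mathlib

open MeasureTheory
open scoped ENNReal

noncomputable section

namespace ContractDesign

/-! ## Contracts

The outcomes are `0, 1, ..., m`, and `0` is the null outcome. A monotone contract paying nothing
for the null outcome is represented by its vector of increment payments: coordinate `i : Fin m`
is the payment for outcome `i + 1` minus the payment for outcome `i`. -/

/-- A contract in its increment representation. -/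
abbrev Contract (m : ℕ) : Type := Fin m → ℝ

/-- The payment that contract `x` specifies for outcome `π`. -/
def pay {m : ℕ} (x : Contract m) (π : Fin (m + 1)) : ℝ :=
  ∑ i : Fin m, if (i : ℕ) < (π : ℕ) then x i else 0

/-- The increment space `[0,1]^m`, i.e. the weakly bounded contracts. -/
def weaklyBounded (m : ℕ) : Set (Contract m) := {x | ∀ i, 0 ≤ x i ∧ x i ≤ 1}

/-- The set `X` of bounded monotone contracts: nonnegative increments, and payments in `[0,1]`. -/
def boundedContracts (m : ℕ) : Set (Contract m) :=
  {x | (∀ i, 0 ≤ x i) ∧ ∀ π, pay x π ≤ 1}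

/-! ## The environment -/

/-- A problem instance with `m` non-null outcomes, worker types `Θ` and effort levels `E`. -/
structure Environment (m : ℕ) (Θ : Type*) (E : Type*) [MeasurableSpace Θ] where
  /-- The supply distribution over types. -/
  supply : Measure Θ
  isProb : IsProbabilityMeasure supply
  /-- The value function of the requester. -/
  value : Fin (m + 1) → ℝ
  value_null : value 0 = 0
  value_mono : Monotone value
  value_le_one : ∀ π, value π ≤ 1
  /-- The null effort level. -/
  nullEffort : E
  /-- The cost function of each type. -/
  cost : Θ → E → ℝ
  cost_null : ∀ θ, cost θ nullEffort = 0
  /-- The production function of each type: `prod θ e π` is the probability of outcome `π`. -/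
  prod : Θ → E → Fin (m + 1) → ℝ
  prod_nonneg : ∀ θ e π, 0 ≤ prod θ e π
  prod_sum : ∀ θ e, ∑ π, prod θ e π = 1
  prod_null : ∀ θ, prod θ nullEffort 0 = 1
  prod_of_ne_null : ∀ θ e, e ≠ nullEffort → prod θ e 0 = 0
  /-- The effort level that a worker of type `θ` chooses when contract `x` is offered. -/
  effort : Θ → Contract m → E
  /-- The chosen effort level maximizes the expected utility of the worker. -/
  effort_optimal : ∀ θ, ∀ x ∈ weaklyBounded m, ∀ e,
    ∑ π, prod θ e π * pay x π - cost θ e ≤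
      ∑ π, prod θ (effort θ x) π * pay x π - cost θ (effort θ x)
  measurable_prod_effort : ∀ x ∈ weaklyBounded m, ∀ π,
    Measurable fun θ => prod θ (effort θ x) π

namespace Environment

variable {m : ℕ} {Θ E : Type*} [MeasurableSpace Θ] (env : Environment m Θ E)

/-- The expected utility of a worker of type `θ` with effort `e` under contract `x`. -/
def workerUtility (θ : Θ) (x : Contract m) (e : E) : ℝ :=
  ∑ π, env.prod θ e π * pay x π - env.cost θ e

/-- `F_θ(π|e)`, the probability of an outcome at least `π` given effort `e`. -/
def tail (θ : Θ) (e : E) (π : Fin (m + 1)) : ℝ := ∑ π' ∈ Finset.Ici π, env.prod θ e π'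

/-- Effort `e` has first-order stochastic dominance over effort `e'` for type `θ`. -/
def Dominates (θ : Θ) (e e' : E) : Prop :=
  (∀ π, env.tail θ e' π ≤ env.tail θ e π) ∧ ∃ π, env.tail θ e' π < env.tail θ e π

/-- All types satisfy the FOSD assumption. -/
def FOSD : Prop :=
  ∀ θ e e', e ≠ e' → env.Dominates θ e e' ∨ env.Dominates θ e' e

/-- Effort `e` is a best response of type `θ` to contract `x`. -/
def IsBest (θ : Θ) (x : Contract m) (e : E) : Prop :=
  ∀ e', env.workerUtility θ x e' ≤ env.workerUtility θ x e

/-- Consistent tie-breaking: a worker who is indifferent between the same two optimal effort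
levels under two contracts does not choose one of them under the first contract and the other
one under the second. -/
def ConsistentTieBreaking : Prop :=
  ∀ θ, ∀ x ∈ weaklyBounded m, ∀ y ∈ weaklyBounded m,
    env.IsBest θ x (env.effort θ y) → env.IsBest θ y (env.effort θ x) →
      env.effort θ x = env.effort θ y

/-- The expectation of `g (outcome)` in a round in which contract `x` is offered: the type is drawn
from the supply distribution, the worker chooses the effort level, and the outcome is drawn
from the production function. -/
def expect (x : Contract m) (g : Fin (m + 1) → ℝ) : ℝ :=
  ∫ θ, ∑ π, env.prod θ (env.effort θ x) π * g π ∂env.supply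

/-- Expected value `V(x)`. -/
def V (x : Contract m) : ℝ := env.expect x env.value

/-- Expected payment `P(x)`. -/
def P (x : Contract m) : ℝ := env.expect x (pay x)

/-- Expected utility `U(x)` of the requester. -/
def U (x : Contract m) : ℝ := env.V x - env.P x

/-- `OPT(Xcand)`. -/
def opt (Xcand : Set (Contract m)) : ℝ := sSup (env.U '' Xcand)

/-- The candidate contracts of badness at most `ε`. -/
def nearOptimal (Xcand : Set (Contract m)) (ε : ℝ) : Set (Contract m) :=
  {x ∈ Xcand | env.opt Xcand - env.U x ≤ ε}

end Environment

/-! ## Cells -/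

/-- An axis-aligned cube in the increment space, given by its minimal corner and its side. -/
@[ext]
structure Cell (m : ℕ) where
  lo : Fin m → ℝ
  side : ℝ

namespace Cell

variable {m : ℕ}

/-- The closed cube. -/
def carrier (C : Cell m) : Set (Contract m) := {x | ∀ i, C.lo i ≤ x i ∧ x i ≤ C.lo i + C.side}

/-- The cell `[0,1]^m`. -/
def root (m : ℕ) : Cell m := ⟨fun _ => 0, 1⟩

/-- The minimal corner `x⁻(C)`. -/
def minCorner (C : Cell m) : Contract m := C.lo

/-- The maximal corner `x⁺(C)`. -/
def maxCorner (C : Cell m) : Contract m := fun i => C.lo i + C.side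

/-- The `2^m` quadrants of a cell, indexed by the subsets of the coordinates. -/
def quadrant (C : Cell m) (s : Fin m → Bool) : Cell m :=
  ⟨fun i => C.lo i + (if s i then C.side / 2 else 0), C.side / 2⟩

/-- The cell contains at least one candidate contract. -/
def Relevant (Xcand : Set (Contract m)) (C : Cell m) : Prop := (C.carrier ∩ Xcand).Nonempty

/-- The cell contains more than one candidate contract. -/
def Composite (Xcand : Set (Contract m)) (C : Cell m) : Prop := (C.carrier ∩ Xcand).Nontrivial

/-- The relevant quadrants of a cell. -/
def relevantQuadrants (Xcand : Set (Contract m)) (C : Cell m) : Set (Cell m) :=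
  {Q | (∃ s, Q = C.quadrant s) ∧ Q.Relevant Xcand}

/-- Feasible cells: the root, and all relevant quadrants of feasible cells. -/
inductive Feasible (Xcand : Set (Contract m)) : Cell m → Prop
  | root : Feasible Xcand (Cell.root m)
  | quadrant (C Q : Cell m) : Feasible Xcand C → Q ∈ C.relevantQuadrants Xcand → Feasible Xcand Q

open Classical in
/-- The anchor of `C` selected by the coin: the maximal (`true`) or minimal (`false`) corner of a
composite cell; the unique candidate contract of an atomic cell, whatever the coin. -/
def anchor (Xcand : Set (Contract m)) (C : Cell m) (coin : Bool) : Contract m :=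
  if C.Composite Xcand then (if coin then C.maxCorner else C.minCorner)
  else if h : C.Relevant Xcand then h.some else C.minCorner

end Cell

namespace Environment

variable {m : ℕ} {Θ E : Type*} [MeasurableSpace Θ] (env : Environment m Θ E)

/-- The virtual width of a cell. -/
def virtualWidth (C : Cell m) : ℝ :=
  (env.V C.maxCorner - env.P C.minCorner) - (env.V C.minCorner - env.P C.maxCorner)

/-- The number `N_ε(Y|Xcand)` of feasible composite cells of virtual width at least `ε` that
overlap with `Y`. -/
def cellCount (Xcand : Set (Contract m)) (ε : ℝ) (Y : Set (Contract m)) : ℕ∞ :=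
  Set.encard {C : Cell m | C.Feasible Xcand ∧ C.Composite Xcand ∧ ε ≤ env.virtualWidth C ∧
    (C.carrier ∩ Y).Nonempty}

end Environment

/-! ## The algorithm -/

/-- The record of one round: the chosen cell, the coin that picks the anchor, and the outcome. -/
structure Round (m : ℕ) where
  cell : Cell m
  coin : Bool
  outcome : Fin (m + 1)

/-- The records of the previous rounds, the most recent one first. -/
abbrev History (m : ℕ) : Type := List (Round m)

/-- The average of a list of reals (`0` for the empty list). -/
def average (l : List ℝ) : ℝ := l.sum / l.length

section Statistics

variable {m : ℕ} {Θ E : Type*} [MeasurableSpace Θ] (env : Environment m Θ E)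
  (Xcand : Set (Contract m))

open Classical in
/-- The rounds of `h` in which cell `C` was chosen. -/
def roundsIn (h : History m) (C : Cell m) : History m := h.filter fun r => r.cell = C

/-- The rounds of `h` in which cell `C` was chosen with the given coin. -/
def roundsAt (h : History m) (C : Cell m) (coin : Bool) : History m :=
  (roundsIn h C).filter fun r => r.coin = coin

/-- The contract posted in a round. -/
def posted (r : Round m) : Contract m := r.cell.anchor Xcand r.coin

/-- `n_t(C)`. -/
def numPlays (h : History m) (C : Cell m) : ℕ := (roundsIn h C).length

/-- `U_t(C)`. -/
def avgUtility (h : History m) (C : Cell m) : ℝ :=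
  average ((roundsIn h C).map fun r => env.value r.outcome - pay (posted Xcand r) r.outcome)

/-- `V⁺_t(C)` (coin `true`) and `V⁻_t(C)` (coin `false`). -/
def avgValue (h : History m) (C : Cell m) (coin : Bool) : ℝ :=
  average ((roundsAt h C coin).map fun r => env.value r.outcome)

/-- `P⁺_t(C)` (coin `true`) and `P⁻_t(C)` (coin `false`). -/
def avgPayment (h : History m) (C : Cell m) (coin : Bool) : ℝ :=
  average ((roundsAt h C coin).map fun r => pay (posted Xcand r) r.outcome)

/-- The width estimate `W_t(C)`. -/
def widthEstimate (h : History m) (C : Cell m) : ℝ :=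
  (avgValue env h C true - avgPayment Xcand h C false) -
    (avgValue env h C false - avgPayment Xcand h C true)

/-- The confidence radius `rad_t(C)`, for a cell that has been chosen at least once. -/
def confRad (c : ℝ) (T : ℕ) (h : History m) (C : Cell m) : ℝ :=
  Real.sqrt (c * Real.log T / numPlays h C)

open Classical in
/-- The index `I_t(C)`. It is infinite for a cell that has not been chosen yet, since the
confidence radius is then infinite. -/
def index (c : ℝ) (T : ℕ) (h : History m) (C : Cell m) : EReal :=
  if numPlays h C = 0 then ⊤
  else if C.Composite Xcand then
    ((avgUtility env Xcand h C + widthEstimate env Xcand h C + 5 * confRad c T h C : ℝ) : EReal)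
  else ((avgUtility env Xcand h C + confRad c T h C : ℝ) : EReal)

open Classical in
/-- The set of active cells after history `h`. After each round the zooming rule is applied to the
cell that has been chosen in that round, with the statistics including that round. -/
def active (c : ℝ) (T : ℕ) : History m → Set (Cell m)
  | [] => {Cell.root m}
  | r :: h =>
    if r.cell.Composite Xcand ∧
        5 * confRad c T (r :: h) r.cell < widthEstimate env Xcand (r :: h) r.cell then
      (active c T h ∪ r.cell.relevantQuadrants Xcand) \ {r.cell}
    else active c T h

/-- `sel` implements the selection rule: after every history it chooses an active cell with
maximal index (ties being broken in any way that depends on the history). -/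
def IsSelectionRule (c : ℝ) (T : ℕ) (sel : History m → Cell m) : Prop :=
  ∀ h, sel h ∈ active env Xcand c T h ∧
    ∀ C ∈ active env Xcand c T h, index env Xcand c T h C ≤ index env Xcand c T h (sel h)

/-- The expected cumulative utility of the algorithm over the next `n` rounds, given the history
`h`. In each round, a fair coin picks the anchor of the chosen cell, a worker with a fresh
type from the supply distribution arrives, and the outcome is realized and recorded. -/
def expectedUtility (sel : History m → Cell m) : ℕ → History m → ℝ
  | 0, _ => 0
  | n + 1, h => ∑ coin : Bool, (1 / 2 : ℝ) *
      env.expect ((sel h).anchor Xcand coin) fun π =>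
        env.value π - pay ((sel h).anchor Xcand coin) π +
          expectedUtility sel n (⟨sel h, coin, π⟩ :: h)

/-- The regret `R(T|Xcand)`. -/
def regret (T : ℕ) (sel : History m → Cell m) : ℝ :=
  T * env.opt Xcand - expectedUtility env Xcand sel T []

end Statistics

end ContractDesign

end

universe u v

open ContractDesign

/-!
Agnostic Zooming is analysed like other zooming algorithms: an optimistic index forces every cell
that keeps being chosen to be nearly optimal, and, with high probability, a cell that is not too
large is only split once its virtual width exceeds its confidence radius.

*Monotonicity.* Under FOSD with consistent tie-breaking, raising the increments of a contract makes
each worker choose a weakly dominating effort level (`Environment.tail_effort_mono`). Hence `V` and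
`P` are monotone, and all utilities inside a cell lie in an interval whose length is the virtual
width (`Instance.U_mem`).

*Randomness.* The play is a finite tree, and its expectation is an iterate of the averaging operator
`step`; by the tower rule the regret is the expected sum of the badnesses of the chosen cells
(`regret_eq`). For each of seven observables, the sum over the cells chosen so far of exponential
Hoeffding supermartingales grows by at most one per round, so all averages concentrate throughout
the play up to an event of probability `O(T⁻¹)`, which costs a constant
(`regret_le_of_concentrated`).

*Large payments.* The corners of large cells may have payments up to `m`, for which the
confidence radius with `c = 16` is too small. Two facts repair this. First, the payments at the
maximal corner enter the index with a nonnegative coefficient, and they dominate the payments that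
the minimal corner specifies for the same outcomes, which are at most `1`; so the index is
optimistic for every cell (`Good.optimism_composite`). Secondly, cells with `m * side ≤ 1` have
payments at most `2`, so their width estimates are reliable with absolute constants, while the
number of quadrants of other cells depends only on `m`.

*Charging.* A cell chosen `n` times has badness `O(√(log T / n))`, and if it is composite and small
then so is its virtual width (`IsSelectionRule.chosen_bounds`). A quadrant of a small cell `Q` is
charged to `Q`, whose virtual width is at least a constant fraction of its badness, since `Q` was
split (`IsSelectionRule.hasParent`); the finitely many coarse cells are charged to the root, whose virtual
width bounds all badnesses (`exists_charge`). Each cell receives a number of charges that depends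
only on `m`, and a charge at scale `ε` is worth `O(log T / ε)`. If some feasible cell has badness
above `δ`, the root is counted at the scale of its virtual width, and this term also absorbs the
constant cost of the failure event; otherwise the regret is at most `δ T`.
-/

namespace ContractDesign

/-! ### Contracts and expectations -/

section Pay

variable {m : ℕ}

lemma pay_zero (x : Contract m) : pay x 0 = 0 := by simp [pay]

lemma pay_mono_left {x y : Contract m} (h : ∀ i, x i ≤ y i) (π : Fin (m + 1)) :
    pay x π ≤ pay y π := by
  unfold pay
  refine Finset.sum_le_sum fun i _ => ?_
  split_ifs
  · exact h i
  · exact le_rfl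

lemma pay_nonneg {x : Contract m} (h : ∀ i, 0 ≤ x i) (π : Fin (m + 1)) : 0 ≤ pay x π := by
  unfold pay
  refine Finset.sum_nonneg fun i _ => ?_
  split_ifs
  · exact h i
  · exact le_rfl

lemma pay_monotone {x : Contract m} (h : ∀ i, 0 ≤ x i) : Monotone (pay x) := by
  intro π π' hπ
  unfold pay
  refine Finset.sum_le_sum fun i _ => ?_
  have hπ' : (π : ℕ) ≤ π' := hπ
  split_ifs with h1 h2
  · exact le_rfl
  · omega
  · exact h i
  · exact le_rfl

lemma pay_add_const_le {x y : Contract m} {s : ℝ} (hs : 0 ≤ s) (h : ∀ i, y i ≤ x i + s)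
    (π : Fin (m + 1)) : pay y π ≤ pay x π + m * s := by
  have h1 : pay y π ≤ ∑ i : Fin m, ((if (i : ℕ) < (π : ℕ) then x i else 0) + s) := by
    unfold pay
    refine Finset.sum_le_sum fun i _ => ?_
    split_ifs
    · exact h i
    · simpa using hs
  simpa [pay, Finset.sum_add_distrib] using h1

lemma boundedContracts_subset : boundedContracts m ⊆ weaklyBounded m := by
  rintro x ⟨h0, h1⟩ i
  refine ⟨h0 i, le_trans ?_ (h1 (Fin.last m))⟩
  have : pay x (Fin.last m) = ∑ i, x i := by simp [pay]
  rw [this]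
  exact Finset.single_le_sum (fun j _ => h0 j) (Finset.mem_univ i)

/-- Every reward function is, up to a constant, the payment function of its increments. -/
lemma exists_eq_add_pay (g : Fin (m + 1) → ℝ) :
    ∀ π, g π = g 0 + pay (fun i : Fin m => g i.succ - g i.castSucc) π := by
  intro π
  induction π using Fin.induction with
  | zero => simp [pay_zero]
  | succ i ih =>
    have : pay (fun i : Fin m => g i.succ - g i.castSucc) i.succ =
        pay (fun i : Fin m => g i.succ - g i.castSucc) i.castSucc + (g i.succ - g i.castSucc) := by
      unfold pay
      rw [← Finset.sum_erase_add _ _ (Finset.mem_univ i),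
        ← Finset.sum_erase_add (a := i) Finset.univ (fun j : Fin m => if (j : ℕ) <
          (i.castSucc : ℕ) then g j.succ - g j.castSucc else 0) (Finset.mem_univ i)]
      have h1 : ∀ j ∈ Finset.univ.erase i,
          (if (j : ℕ) < (i.succ : ℕ) then g j.succ - g j.castSucc else 0) =
          (if (j : ℕ) < (i.castSucc : ℕ) then g j.succ - g j.castSucc else 0) := by
        intro j hj
        have hne : (j : ℕ) ≠ i := fun h => (Finset.mem_erase.1 hj).1 (Fin.ext h)
        have : ((j : ℕ) < (i.succ : ℕ)) ↔ ((j : ℕ) < (i.castSucc : ℕ)) := by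
          simp only [Fin.val_succ, Fin.val_castSucc]; omega
        simp only [this]
      rw [Finset.sum_congr rfl h1]
      simp
    rw [this]
    linarith

end Pay

namespace Environment

variable {m : ℕ} {Θ E : Type*} [MeasurableSpace Θ] (env : Environment m Θ E)

lemma value_nonneg (π : Fin (m + 1)) : 0 ≤ env.value π := by
  rw [← env.value_null]; exact env.value_mono (Fin.zero_le π)

/-- The probability that outcome `π` is observed when contract `x` is posted, averaged over the
supply of workers. -/
noncomputable def outcomeProb (x : Contract m) (π : Fin (m + 1)) : ℝ :=
  ∫ θ, env.prod θ (env.effort θ x) π ∂env.supply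

lemma prod_le_one (θ : Θ) (e : E) (π : Fin (m + 1)) : env.prod θ e π ≤ 1 := by
  rw [← env.prod_sum θ e]
  exact Finset.single_le_sum (fun j _ => env.prod_nonneg θ e j) (Finset.mem_univ π)

lemma integrable_prod {x : Contract m} (hx : x ∈ weaklyBounded m) (π : Fin (m + 1)) :
    Integrable (fun θ => env.prod θ (env.effort θ x) π) env.supply := by
  have := env.isProb
  refine Integrable.of_bound (env.measurable_prod_effort x hx π).aestronglyMeasurable 1 ?_
  refine Filter.Eventually.of_forall fun θ => ?_
  rw [Real.norm_eq_abs, abs_of_nonneg (env.prod_nonneg _ _ _)]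
  exact env.prod_le_one _ _ _

lemma outcomeProb_nonneg (x : Contract m) (π : Fin (m + 1)) : 0 ≤ env.outcomeProb x π :=
  integral_nonneg fun _ => env.prod_nonneg _ _ _

lemma expect_eq_sum {x : Contract m} (hx : x ∈ weaklyBounded m) (g : Fin (m + 1) → ℝ) :
    env.expect x g = ∑ π, env.outcomeProb x π * g π := by
  unfold expect outcomeProb
  rw [integral_finsetSum]
  · simp only [integral_mul_const]
  · exact fun π _ => (env.integrable_prod hx π).mul_const _

lemma outcomeProb_sum {x : Contract m} (hx : x ∈ weaklyBounded m) :
    ∑ π, env.outcomeProb x π = 1 := by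
  have := env.isProb
  have := env.expect_eq_sum hx (fun _ => 1)
  simp only [mul_one] at this
  rw [← this]
  simp [expect, env.prod_sum]

lemma expect_mono {x : Contract m} (hx : x ∈ weaklyBounded m) {g g' : Fin (m + 1) → ℝ}
    (h : ∀ π, g π ≤ g' π) : env.expect x g ≤ env.expect x g' := by
  rw [env.expect_eq_sum hx, env.expect_eq_sum hx]
  exact Finset.sum_le_sum fun π _ => mul_le_mul_of_nonneg_left (h π) (env.outcomeProb_nonneg x π)

lemma expect_const {x : Contract m} (hx : x ∈ weaklyBounded m) (a : ℝ) :
    env.expect x (fun _ => a) = a := by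
  rw [env.expect_eq_sum hx, ← Finset.sum_mul, env.outcomeProb_sum hx, one_mul]

lemma expect_sub {x : Contract m} (hx : x ∈ weaklyBounded m) (g g' : Fin (m + 1) → ℝ) :
    env.expect x (fun π => g π - g' π) = env.expect x g - env.expect x g' := by
  simp only [env.expect_eq_sum hx, mul_sub, Finset.sum_sub_distrib]

lemma U_eq_expect {x : Contract m} (hx : x ∈ weaklyBounded m) :
    env.U x = env.expect x (fun π => env.value π - pay x π) :=
  (env.expect_sub hx _ _).symm

lemma V_mem {x : Contract m} (hx : x ∈ weaklyBounded m) : 0 ≤ env.V x ∧ env.V x ≤ 1 :=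
  ⟨by simpa [V, env.expect_const hx] using env.expect_mono hx env.value_nonneg,
   by simpa [V, env.expect_const hx] using env.expect_mono hx env.value_le_one⟩

lemma P_nonneg {x : Contract m} (hx : x ∈ weaklyBounded m) : 0 ≤ env.P x := by
  simpa [P, env.expect_const hx] using env.expect_mono hx (pay_nonneg fun i => (hx i).1)

lemma P_le {x : Contract m} (hx : x ∈ weaklyBounded m) {B : ℝ} (h : ∀ π, pay x π ≤ B) :
    env.P x ≤ B := by
  simpa [P, env.expect_const hx] using env.expect_mono hx h

/-! ### Monotonicity under first-order stochastic dominance -/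

/-- Summation by parts: the expected payment is the sum of the increments weighted by the
tail probabilities. -/
lemma sum_prod_pay (θ : Θ) (e : E) (x : Contract m) :
    ∑ π, env.prod θ e π * pay x π = ∑ i : Fin m, x i * env.tail θ e i.succ := by
  unfold pay tail
  simp only [Finset.mul_sum]
  rw [Finset.sum_comm]
  refine Finset.sum_congr rfl fun i _ => ?_
  have : Finset.Ici i.succ = Finset.univ.filter fun π : Fin (m + 1) => (i : ℕ) < (π : ℕ) := by
    ext π
    simp [Fin.le_def]
  rw [this, Finset.sum_filter]
  refine Finset.sum_congr rfl fun π _ => ?_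
  split_ifs <;> ring

/-- Raising increments makes every worker choose a (weakly) dominating effort level. -/
lemma tail_effort_mono (hF : env.FOSD) (hT : env.ConsistentTieBreaking) {x y : Contract m}
    (hx : x ∈ weaklyBounded m) (hy : y ∈ weaklyBounded m) (hxy : ∀ i, x i ≤ y i) (θ : Θ)
    (π : Fin (m + 1)) :
    env.tail θ (env.effort θ x) π ≤ env.tail θ (env.effort θ y) π := by
  by_cases heq : env.effort θ x = env.effort θ y
  · rw [heq]
  rcases hF θ _ _ heq with hd | hd
  · exfalso
    apply heq
    -- The effort under `x` dominates, so its advantage over the other one only grows from `x`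
    -- to `y`; optimality on both sides then forces indifference under both contracts.
    have h1 := env.effort_optimal θ x hx (env.effort θ y)
    have h2 := env.effort_optimal θ y hy (env.effort θ x)
    have h3 : ∑ i : Fin m, x i * env.tail θ (env.effort θ x) i.succ +
        ∑ i : Fin m, y i * env.tail θ (env.effort θ y) i.succ ≤
        ∑ i : Fin m, y i * env.tail θ (env.effort θ x) i.succ +
        ∑ i : Fin m, x i * env.tail θ (env.effort θ y) i.succ := by
      rw [← Finset.sum_add_distrib, ← Finset.sum_add_distrib]
      refine Finset.sum_le_sum fun i _ => ?_
      nlinarith [hd.1 i.succ, hxy i]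
    refine hT θ x hx y hy ?_ ?_
    · intro e'
      have h4 := env.effort_optimal θ x hx e'
      simp only [workerUtility, sum_prod_pay] at *
      linarith
    · intro e'
      have h4 := env.effort_optimal θ y hy e'
      simp only [workerUtility, sum_prod_pay] at *
      linarith
  · exact hd.1 π

lemma expect_mono_contract (hF : env.FOSD) (hT : env.ConsistentTieBreaking) {x y : Contract m}
    (hx : x ∈ weaklyBounded m) (hy : y ∈ weaklyBounded m) (hxy : ∀ i, x i ≤ y i)
    {g : Fin (m + 1) → ℝ} (hg : Monotone g) : env.expect x g ≤ env.expect y g := by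
  unfold expect
  refine integral_mono (integrable_finsetSum _ fun π _ => (env.integrable_prod hx π).mul_const _)
    (integrable_finsetSum _ fun π _ => (env.integrable_prod hy π).mul_const _) fun θ => ?_
  have key : ∀ e, ∑ π, env.prod θ e π * g π =
      g 0 + ∑ i : Fin m, (g i.succ - g i.castSucc) * env.tail θ e i.succ := by
    intro e
    rw [← sum_prod_pay]
    conv_lhs => enter [2, π]; rw [exists_eq_add_pay g π, mul_add]
    rw [Finset.sum_add_distrib, ← Finset.sum_mul, env.prod_sum, one_mul]
  simp only [key]
  gcongr with i _
  · exact sub_nonneg.2 (hg (Fin.castSucc_lt_succ).le)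
  · exact env.tail_effort_mono hF hT hx hy hxy θ _

lemma V_mono (hF : env.FOSD) (hT : env.ConsistentTieBreaking) {x y : Contract m}
    (hx : x ∈ weaklyBounded m) (hy : y ∈ weaklyBounded m) (hxy : ∀ i, x i ≤ y i) :
    env.V x ≤ env.V y :=
  env.expect_mono_contract hF hT hx hy hxy env.value_mono

lemma P_le_expect_pay (hF : env.FOSD) (hT : env.ConsistentTieBreaking) {x y : Contract m}
    (hx : x ∈ weaklyBounded m) (hy : y ∈ weaklyBounded m) (hxy : ∀ i, x i ≤ y i) :
    env.P x ≤ env.expect y (pay x) :=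
  env.expect_mono_contract hF hT hx hy hxy (pay_monotone fun i => (hx i).1)

lemma P_mono (hF : env.FOSD) (hT : env.ConsistentTieBreaking) {x y : Contract m}
    (hx : x ∈ weaklyBounded m) (hy : y ∈ weaklyBounded m) (hxy : ∀ i, x i ≤ y i) :
    env.P x ≤ env.P y :=
  (env.P_le_expect_pay hF hT hx hy hxy).trans (env.expect_mono hy (pay_mono_left hxy))

/-- The utility of a contract between `x` and `z` lies in an interval whose length is the virtual
width of the cell with corners `x` and `z`. -/
lemma U_mem_of_between (hF : env.FOSD) (hT : env.ConsistentTieBreaking) {x y z : Contract m}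
    (hx : x ∈ weaklyBounded m) (hy : y ∈ weaklyBounded m) (hz : z ∈ weaklyBounded m)
    (hxy : ∀ i, x i ≤ y i) (hyz : ∀ i, y i ≤ z i) :
    env.V x - env.P z ≤ env.U y ∧ env.U y ≤ env.V z - env.P x := by
  have := env.V_mono hF hT hx hy hxy
  have := env.V_mono hF hT hy hz hyz
  have := env.P_mono hF hT hx hy hxy
  have := env.P_mono hF hT hy hz hyz
  unfold U
  constructor <;> linarith

end Environment

/-! ### Geometry of cells -/

namespace Cell

variable {m : ℕ} {Xcand : Set (Contract m)} {C Q : Cell m}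

lemma mem_carrier_root {x : Contract m} : x ∈ (root m).carrier ↔ x ∈ weaklyBounded m := by
  simp [carrier, root, weaklyBounded]

lemma quadrant_side (C : Cell m) (s : Fin m → Bool) : (C.quadrant s).side = C.side / 2 := rfl

lemma quadrant_carrier_subset (hC : 0 ≤ C.side) (s : Fin m → Bool) :
    (C.quadrant s).carrier ⊆ C.carrier := by
  intro x hx i
  have := hx i
  simp only [quadrant] at this
  split_ifs at this <;> constructor <;> linarith

lemma exists_quadrant_mem {x : Contract m} (hx : x ∈ C.carrier) :
    ∃ s, x ∈ (C.quadrant s).carrier := by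
  classical
  refine ⟨fun i => decide (C.lo i + C.side / 2 ≤ x i), fun i => ?_⟩
  have := hx i
  by_cases h : C.lo i + C.side / 2 ≤ x i
  · simp only [quadrant, h, decide_true, if_true]
    exact ⟨trivial, by linarith⟩
  · simp only [quadrant, h, decide_false]
    simp only [Bool.false_eq_true, if_false]
    constructor <;> linarith

/-- The sub-cubes of the root obtained by `k` successive halvings. -/
noncomputable def dyadic (m : ℕ) : ℕ → Finset (Cell m)
  | 0 => {root m}
  | k + 1 =>
    open Classical in (dyadic m k).biUnion fun C => Finset.univ.image C.quadrant

lemma quadrant_mem_dyadic {k : ℕ} (h : C ∈ dyadic m k) (s : Fin m → Bool) :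
    C.quadrant s ∈ dyadic m (k + 1) := by
  classical
  simp only [dyadic, Finset.mem_biUnion, Finset.mem_image, Finset.mem_univ, true_and]
  exact ⟨C, h, s, rfl⟩

lemma Feasible.exists_dyadic (h : C.Feasible Xcand) :
    ∃ k, C ∈ dyadic m k ∧ C.side = (1 / 2) ^ k := by
  induction h with
  | root => exact ⟨0, by simp [dyadic], by simp [Cell.root]⟩
  | quadrant C Q _ hQ ih =>
    obtain ⟨k, hk, hs⟩ := ih
    obtain ⟨⟨s, rfl⟩, _⟩ := hQ
    exact ⟨k + 1, quadrant_mem_dyadic hk s, by rw [quadrant_side, hs]; ring⟩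

lemma Feasible.side_pos (h : C.Feasible Xcand) : 0 < C.side := by
  obtain ⟨k, _, hk⟩ := h.exists_dyadic
  rw [hk]; positivity

lemma Feasible.side_le_one (h : C.Feasible Xcand) : C.side ≤ 1 := by
  obtain ⟨k, _, hk⟩ := h.exists_dyadic
  rw [hk]; exact pow_le_one₀ (by norm_num) (by norm_num)

lemma Feasible.carrier_subset (h : C.Feasible Xcand) : C.carrier ⊆ weaklyBounded m := by
  induction h with
  | root => intro x hx; exact mem_carrier_root.1 hx
  | quadrant C Q hC hQ ih =>
    obtain ⟨⟨s, rfl⟩, _⟩ := hQ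
    exact (quadrant_carrier_subset hC.side_pos.le s).trans ih

lemma Feasible.relevant (hX : Xcand ⊆ boundedContracts m) (hne : Xcand.Nonempty)
    (h : C.Feasible Xcand) : C.Relevant Xcand := by
  cases h with
  | root =>
    obtain ⟨x, hx⟩ := hne
    exact ⟨x, mem_carrier_root.2 (boundedContracts_subset (hX hx)), hx⟩
  | quadrant C Q _ hQ => exact hQ.2

lemma minCorner_mem (h : 0 ≤ C.side) : C.minCorner ∈ C.carrier :=
  fun _ => ⟨le_rfl, by simpa [minCorner] using h⟩

lemma maxCorner_mem (h : 0 ≤ C.side) : C.maxCorner ∈ C.carrier :=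
  fun _ => ⟨by simpa [maxCorner] using h, le_rfl⟩

lemma anchor_true (h : C.Composite Xcand) : C.anchor Xcand true = C.maxCorner := by
  simp [anchor, h]

lemma anchor_false (h : C.Composite Xcand) : C.anchor Xcand false = C.minCorner := by
  simp [anchor, h]

lemma anchor_atomic (h : ¬ C.Composite Xcand) {y : Contract m} (hy : y ∈ C.carrier ∩ Xcand)
    (b : Bool) : C.anchor Xcand b = y := by
  have hr : C.Relevant Xcand := ⟨y, hy⟩
  simp only [anchor, h, if_false, dif_pos hr]
  exact Set.not_nontrivial_iff.1 h hr.some_mem hy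

lemma anchor_mem_carrier (hs : 0 ≤ C.side) (hr : C.Relevant Xcand) (b : Bool) :
    C.anchor Xcand b ∈ C.carrier := by
  by_cases h : C.Composite Xcand
  · cases b
    · rw [anchor_false h]; exact minCorner_mem hs
    · rw [anchor_true h]; exact maxCorner_mem hs
  · obtain ⟨y, hy⟩ := hr
    rw [anchor_atomic h hy]; exact hy.1

end Cell

/-- The standing assumptions on the problem instance and on the candidate contracts. -/
structure Instance {m : ℕ} {Θ E : Type*} [MeasurableSpace Θ] (env : Environment m Θ E)
    (Xcand : Set (Contract m)) : Prop where
  fosd : env.FOSD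
  ties : env.ConsistentTieBreaking
  subset : Xcand ⊆ boundedContracts m
  nonempty : Xcand.Nonempty

open Classical in
/-- The length of an interval containing the realized utility of all rounds in which `C` is
chosen: payments are at most `1 + m * side` at the corners of a relevant cell, and at most `1` at
a candidate contract. -/
noncomputable def Cell.utilityRange {m : ℕ} (Xcand : Set (Contract m)) (C : Cell m) : ℝ :=
  if C.Composite Xcand then 2 + m * C.side else 2

section

variable {m : ℕ} {Xcand : Set (Contract m)} {C : Cell m}

lemma Cell.Feasible.pay_nonneg (hC : C.Feasible Xcand) {x : Contract m} (hx : x ∈ C.carrier)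
    (π : Fin (m + 1)) : 0 ≤ pay x π :=
  ContractDesign.pay_nonneg (fun i => (hC.carrier_subset hx i).1) π

lemma Cell.Feasible.two_le_utilityRange (hC : C.Feasible Xcand) : 2 ≤ C.utilityRange Xcand := by
  have := hC.side_pos
  unfold Cell.utilityRange
  split_ifs
  · have : (0 : ℝ) ≤ m * C.side := by positivity
    linarith
  · exact le_rfl

lemma Cell.Feasible.utilityRange_le (hC : C.Feasible Xcand) : C.utilityRange Xcand ≤ 2 + m := by
  have h1 := hC.side_le_one
  have h2 := hC.side_pos
  have h3 : (0 : ℝ) ≤ m := Nat.cast_nonneg m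
  unfold Cell.utilityRange
  split_ifs
  · nlinarith
  · linarith

lemma Environment.U_le_one {Θ E : Type*} [MeasurableSpace Θ]
    (env : Environment m Θ E) {x : Contract m} (hx : x ∈ weaklyBounded m) : env.U x ≤ 1 := by
  unfold Environment.U
  linarith [(env.V_mem hx).2, env.P_nonneg hx]

end

namespace Environment

variable {m : ℕ} {Θ E : Type*} [MeasurableSpace Θ] (env : Environment m Θ E)

/-- The expected utility of a round in which cell `C` is chosen. -/
noncomputable def cellUtility (Xcand : Set (Contract m)) (C : Cell m) : ℝ :=
  ∑ b : Bool, (1 / 2 : ℝ) * env.U (C.anchor Xcand b)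

end Environment

namespace Instance

variable {m : ℕ} {Θ E : Type*} [MeasurableSpace Θ] {env : Environment m Θ E}
  {Xcand : Set (Contract m)} (I : Instance env Xcand) {C Q : Cell m}
include I

lemma anchor_mem (hC : C.Feasible Xcand) (b : Bool) : C.anchor Xcand b ∈ C.carrier :=
  Cell.anchor_mem_carrier hC.side_pos.le (hC.relevant I.subset I.nonempty) b

lemma anchor_weaklyBounded (hC : C.Feasible Xcand) (b : Bool) :
    C.anchor Xcand b ∈ weaklyBounded m :=
  hC.carrier_subset (I.anchor_mem hC b)

lemma pay_minCorner_le (hC : C.Feasible Xcand) (π : Fin (m + 1)) : pay C.minCorner π ≤ 1 := by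
  obtain ⟨y, hy, hyX⟩ := hC.relevant I.subset I.nonempty
  exact (pay_mono_left (fun i => (hy i).1) π).trans ((I.subset hyX).2 π)

lemma pay_maxCorner_le (hC : C.Feasible Xcand) (π : Fin (m + 1)) :
    pay C.maxCorner π ≤ 1 + m * C.side := by
  have := pay_add_const_le (x := C.minCorner) (y := C.maxCorner) hC.side_pos.le
    (fun _ => le_rfl) π
  linarith [I.pay_minCorner_le hC π]

lemma pay_anchor_le (hC : C.Feasible Xcand) (b : Bool) (π : Fin (m + 1)) :
    pay (C.anchor Xcand b) π ≤ C.utilityRange Xcand - 1 := by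
  have h0 := hC.side_pos
  by_cases h : C.Composite Xcand
  · rw [Cell.utilityRange, if_pos h]
    have : (0 : ℝ) ≤ m * C.side := by positivity
    cases b
    · rw [Cell.anchor_false h]; linarith [I.pay_minCorner_le hC π]
    · rw [Cell.anchor_true h]; linarith [I.pay_maxCorner_le hC π]
  · obtain ⟨y, hy⟩ := hC.relevant I.subset I.nonempty
    rw [Cell.anchor_atomic h hy, Cell.utilityRange, if_neg h]
    linarith [(I.subset hy.2).2 π]

/-- All utilities inside a feasible cell lie in the interval
`[V(x⁻) - P(x⁺), V(x⁺) - P(x⁻)]`. -/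
lemma U_mem (hQ : Q.Feasible Xcand) {x : Contract m} (hx : x ∈ Q.carrier) :
    env.V Q.minCorner - env.P Q.maxCorner ≤ env.U x ∧
      env.U x ≤ env.V Q.maxCorner - env.P Q.minCorner :=
  env.U_mem_of_between I.fosd I.ties
    (hQ.carrier_subset (Cell.minCorner_mem hQ.side_pos.le)) (hQ.carrier_subset hx)
    (hQ.carrier_subset (Cell.maxCorner_mem hQ.side_pos.le)) (fun i => (hx i).1) (fun i => (hx i).2)

lemma cellUtility_mem (hQ : Q.Feasible Xcand) (hC : C.Feasible Xcand)
    (hCQ : C.carrier ⊆ Q.carrier) :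
    env.V Q.minCorner - env.P Q.maxCorner ≤ env.cellUtility Xcand C ∧
      env.cellUtility Xcand C ≤ env.V Q.maxCorner - env.P Q.minCorner := by
  have h1 := I.U_mem hQ (hCQ (I.anchor_mem hC true))
  have h2 := I.U_mem hQ (hCQ (I.anchor_mem hC false))
  simp only [Environment.cellUtility, Fintype.sum_bool]
  constructor <;> linarith [h1.1, h1.2, h2.1, h2.2]

lemma opt_le {B : ℝ} (h : ∀ x ∈ Xcand, env.U x ≤ B) : env.opt Xcand ≤ B := by
  refine csSup_le (I.nonempty.image _) ?_
  rintro _ ⟨x, hx, rfl⟩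
  exact h x hx

lemma opt_le_one : env.opt Xcand ≤ 1 :=
  I.opt_le fun _ hx => env.U_le_one (boundedContracts_subset (I.subset hx))

lemma nearOptimal_nonempty {ε : ℝ} (hε : 0 < ε) : (env.nearOptimal Xcand ε).Nonempty := by
  obtain ⟨_, ⟨x, hx, rfl⟩, h⟩ := exists_lt_of_lt_csSup (I.nonempty.image env.U)
    (show env.opt Xcand - ε < sSup (env.U '' Xcand) by
      change env.opt Xcand - ε < env.opt Xcand; linarith)
  exact ⟨x, hx, by linarith⟩

/-- The optimum is attained up to the virtual width of the root, which contains all candidates. -/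
lemma opt_le_root : env.opt Xcand ≤
    env.V (Cell.root m).maxCorner - env.P (Cell.root m).minCorner :=
  I.opt_le fun _ hx => (I.U_mem .root
    (Cell.mem_carrier_root.2 (boundedContracts_subset (I.subset hx)))).2

lemma badness_le_root (hC : C.Feasible Xcand) :
    env.opt Xcand - env.cellUtility Xcand C ≤ env.virtualWidth (Cell.root m) := by
  have h1 := (I.cellUtility_mem .root hC
    (fun x hx => Cell.mem_carrier_root.2 (hC.carrier_subset hx))).1
  have h2 := I.opt_le_root
  unfold Environment.virtualWidth
  linarith

lemma cellUtility_ge (hC : C.Feasible Xcand) : -(1 + m : ℝ) ≤ env.cellUtility Xcand C := by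
  have h : ∀ b, -(1 + m : ℝ) ≤ env.U (C.anchor Xcand b) := by
    intro b
    have hb := I.anchor_weaklyBounded hC b
    have h2 := env.P_le hb (I.pay_anchor_le hC b)
    unfold Environment.U
    linarith [(env.V_mem hb).1, hC.utilityRange_le]
  simp only [Environment.cellUtility, Fintype.sum_bool]
  linarith [h true, h false]

lemma virtualWidth_root_le : env.virtualWidth (Cell.root m) ≤ 2 + m := by
  have hf : (Cell.root m).Feasible Xcand := .root
  have h1 := hf.carrier_subset (Cell.minCorner_mem hf.side_pos.le)
  have h2 := hf.carrier_subset (Cell.maxCorner_mem hf.side_pos.le)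
  have h3 := env.P_le h2 (I.pay_maxCorner_le hf)
  unfold Environment.virtualWidth
  have : (Cell.root m).side = 1 := rfl
  rw [this] at h3
  linarith [(env.V_mem h1).1, (env.V_mem h2).2, env.P_nonneg h1]

/-- If there is only one candidate contract, every feasible cell is atomic with that contract as
its anchor. -/
lemma cellUtility_of_root_atomic (hr : ¬ (Cell.root m).Composite Xcand)
    (hC : C.Feasible Xcand) : env.cellUtility Xcand C = env.opt Xcand := by
  have hsub : Xcand.Subsingleton := by
    have h := Set.not_nontrivial_iff.1 hr
    intro x hx y hy
    exact h ⟨Cell.mem_carrier_root.2 (boundedContracts_subset (I.subset hx)), hx⟩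
      ⟨Cell.mem_carrier_root.2 (boundedContracts_subset (I.subset hy)), hy⟩
  obtain ⟨y, hy⟩ := hC.relevant I.subset I.nonempty
  have hC' : ¬ C.Composite Xcand := Set.not_nontrivial_iff.2 (hsub.anti Set.inter_subset_right)
  have hX : Xcand = {y} := hsub.eq_singleton_of_mem hy.2
  simp only [Environment.cellUtility, Fintype.sum_bool, Cell.anchor_atomic hC' hy]
  rw [Environment.opt, hX]
  simp
  ring

end Instance

/-! ### Hoeffding's lemma for finite distributions -/

/-- Hoeffding's lemma for weights on a finite type. -/
lemma sum_mul_exp_le_of_mem_Icc {α : Type*} [Fintype α] {q g : α → ℝ} (hq : ∀ a, 0 ≤ q a)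
    (hq1 : ∑ a, q a = 1) (hg : ∀ a, 0 ≤ g a ∧ g a ≤ 1) (t : ℝ) :
    ∑ a, q a * Real.exp (t * (g a - ∑ a', q a' * g a')) ≤ Real.exp (t ^ 2 / 8) := by
  let _ : MeasurableSpace α := ⊤
  have : MeasurableSingletonClass α := ⟨fun _ => trivial⟩
  let p : PMF α := PMF.ofFintype (fun a => ENNReal.ofReal (q a)) (by
    rw [← ENNReal.ofReal_sum_of_nonneg fun a _ => hq a, hq1, ENNReal.ofReal_one])
  have hint : ∀ f : α → ℝ, ∫ a, f a ∂p.toMeasure = ∑ a, q a * f a := by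
    intro f
    rw [PMF.integral_eq_sum]
    refine Finset.sum_congr rfl fun a _ => ?_
    simp [p, PMF.ofFintype_apply, ENNReal.toReal_ofReal (hq a)]
  have h := (ProbabilityTheory.hasSubgaussianMGF_of_mem_Icc (μ := p.toMeasure) (X := g)
    (a := 0) (b := 1) (measurable_from_top).aemeasurable
    (Filter.Eventually.of_forall hg)).mgf_le t
  rw [ProbabilityTheory.mgf, hint, hint] at h
  refine h.trans (le_of_eq ?_)
  congr 1
  simp
  ring

/-! ### The random process as an iterated averaging operator -/

lemma sum_map_const_sub {m : ℕ} (a : ℝ) (f : Cell m → ℝ) (h : History m) :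
    (h.map fun r => a - f r.cell).sum = h.length * a - (h.map fun r => f r.cell).sum := by
  induction h with
  | nil => simp
  | cons r h ih => simp only [List.map_cons, List.sum_cons, ih, List.length_cons]; push_cast; ring

section Averaging

variable {m : ℕ} {Θ E : Type*} [MeasurableSpace Θ] (env : Environment m Θ E)
  (Xcand : Set (Contract m))

/-- The expectation of `f coin outcome` in a round in which cell `C` is chosen. -/
noncomputable def cellExpect (C : Cell m) (f : Bool → Fin (m + 1) → ℝ) : ℝ :=
  ∑ b, (1 / 2 : ℝ) * ∑ π, env.outcomeProb (C.anchor Xcand b) π * f b π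

/-- The averaging operator of one round: `step F h` is the expectation of `F` after one more
round, given the history `h`. -/
noncomputable def step (sel : History m → Cell m) :
    (History m → ℝ) →ₗ[ℝ] (History m → ℝ) where
  toFun F h := cellExpect env Xcand (sel h) fun b π => F (⟨sel h, b, π⟩ :: h)
  map_add' F G := by
    ext h
    simp only [cellExpect, Pi.add_apply, mul_add, Finset.sum_add_distrib]
  map_smul' a F := by
    ext h
    simp only [cellExpect, Pi.smul_apply, smul_eq_mul, RingHom.id_apply, Finset.mul_sum]
    refine Finset.sum_congr rfl fun b _ => Finset.sum_congr rfl fun π _ => by ring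

/-- The expectation of a function of the history after `n` rounds. -/
noncomputable def processExpect (sel : History m → Cell m) (n : ℕ) :
    (History m → ℝ) →ₗ[ℝ] ℝ :=
  (LinearMap.proj []).comp (step env Xcand sel ^ n)

/-- Histories in which all cells have been chosen by the rule `sel`. -/
inductive Reach (sel : History m → Cell m) : History m → Prop
  | nil : Reach sel []
  | cons (h : History m) (b : Bool) (π : Fin (m + 1)) :
      Reach sel h → Reach sel (⟨sel h, b, π⟩ :: h)

variable {env Xcand} {sel : History m → Cell m}

lemma cellExpect_mono {C : Cell m} {f f' : Bool → Fin (m + 1) → ℝ} (h : ∀ b π, f b π ≤ f' b π) :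
    cellExpect env Xcand C f ≤ cellExpect env Xcand C f' := by
  unfold cellExpect
  gcongr with b _ π _
  · exact env.outcomeProb_nonneg _ _
  · exact h b π

lemma cellExpect_add {C : Cell m} (f f' : Bool → Fin (m + 1) → ℝ) :
    cellExpect env Xcand C (fun b π => f b π + f' b π) =
      cellExpect env Xcand C f + cellExpect env Xcand C f' := by
  simp only [cellExpect, mul_add, Finset.sum_add_distrib]

lemma cellExpect_const_mul {C : Cell m} (a : ℝ) (f : Bool → Fin (m + 1) → ℝ) :
    cellExpect env Xcand C (fun b π => a * f b π) = a * cellExpect env Xcand C f := by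
  simp only [cellExpect, Finset.mul_sum]
  exact Finset.sum_congr rfl fun b _ => Finset.sum_congr rfl fun π _ => by ring

lemma Instance.cellExpect_const (I : Instance env Xcand) {C : Cell m} (hC : C.Feasible Xcand)
    (a : ℝ) : cellExpect env Xcand C (fun _ _ => a) = a := by
  simp only [cellExpect, ← Finset.sum_mul, env.outcomeProb_sum (I.anchor_weaklyBounded hC _)]
  simp

lemma Instance.cellUtility_eq_cellExpect (I : Instance env Xcand) {C : Cell m}
    (hC : C.Feasible Xcand) : env.cellUtility Xcand C =
      cellExpect env Xcand C fun b π => env.value π - pay (C.anchor Xcand b) π := by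
  unfold Environment.cellUtility cellExpect
  refine Finset.sum_congr rfl fun b _ => ?_
  rw [env.U_eq_expect (I.anchor_weaklyBounded hC b),
    env.expect_eq_sum (I.anchor_weaklyBounded hC b)]

lemma step_apply (F : History m → ℝ) (h : History m) : step env Xcand sel F h =
    cellExpect env Xcand (sel h) fun b π => F (⟨sel h, b, π⟩ :: h) := rfl

lemma step_pow_mono (n : ℕ) : ∀ {F G : History m → ℝ} {h : History m}, Reach sel h →
    (∀ h', Reach sel h' → h'.length = h.length + n → F h' ≤ G h') →
    (step env Xcand sel ^ n) F h ≤ (step env Xcand sel ^ n) G h := by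
  induction n with
  | zero => intro F G h hr hFG; simpa using hFG h hr rfl
  | succ n ih =>
    intro F G h hr hFG
    rw [pow_succ, Module.End.mul_apply, Module.End.mul_apply]
    refine ih hr fun h' hr' hl => ?_
    simp only [step_apply]
    exact cellExpect_mono fun b π => hFG _ (.cons h' b π hr') (by simp [hl]; ring)

lemma processExpect_mono {n : ℕ} {F G : History m → ℝ}
    (hFG : ∀ h, Reach sel h → h.length = n → F h ≤ G h) :
    processExpect env Xcand sel n F ≤ processExpect env Xcand sel n G :=
  step_pow_mono n .nil fun h hr hl => hFG h hr (by simpa using hl)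

lemma processExpect_succ (n : ℕ) (F : History m → ℝ) :
    processExpect env Xcand sel (n + 1) F =
      processExpect env Xcand sel n (step env Xcand sel F) := by
  simp only [processExpect, LinearMap.comp_apply, pow_succ, Module.End.mul_apply]

/-- The sum of `F` over all initial segments of the play recorded in a history. -/
noncomputable def pathSum (F : History m → ℝ) : History m → ℝ
  | [] => F []
  | r :: h => F (r :: h) + pathSum F h

/-- The property `p` holds at all times of the play recorded in a history. -/
def AlongPath (p : History m → Prop) : History m → Prop
  | [] => p []
  | r :: h => p (r :: h) ∧ AlongPath p h

lemma AlongPath.self {p : History m → Prop} {h : History m} (hp : AlongPath p h) : p h := by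
  cases h with
  | nil => exact hp
  | cons r h => exact hp.1

lemma pathSum_nonneg {F : History m → ℝ} (hF : ∀ h, 0 ≤ F h) (h : History m) :
    0 ≤ pathSum F h := by
  induction h with
  | nil => exact hF _
  | cons r h ih => exact add_nonneg (hF _) ih

lemma one_le_pathSum {p : History m → Prop} {F : History m → ℝ} {n : ℕ} (hF : ∀ h, 0 ≤ F h)
    (hp : ∀ h, h.length ≤ n → ¬ p h → 1 ≤ F h) {h : History m} (hl : h.length ≤ n)
    (hh : ¬ AlongPath p h) : 1 ≤ pathSum F h := by
  induction h with
  | nil => exact hp _ hl hh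
  | cons r h ih =>
    by_cases h1 : p (r :: h)
    · have h2 : ¬ AlongPath p h := fun h2 => hh ⟨h1, h2⟩
      have h3 := ih (by simp at hl; omega) h2
      simp only [pathSum]
      linarith [hF (r :: h)]
    · have h2 := hp _ hl h1
      simp only [pathSum]
      linarith [pathSum_nonneg hF h]

section

variable (I : Instance env Xcand) (hsel : ∀ h, Reach sel h → (sel h).Feasible Xcand)
include I hsel

lemma processExpect_const (n : ℕ) (a : ℝ) : processExpect env Xcand sel n (fun _ => a) = a := by
  induction n with
  | zero => simp [processExpect]
  | succ n ih =>
    rw [processExpect_succ]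
    refine Eq.trans (le_antisymm ?_ ?_) ih <;>
    · refine processExpect_mono fun h hr _ => ?_
      rw [step_apply, I.cellExpect_const (hsel h hr)]

lemma processExpect_le_of_step_le {M : History m → ℝ} {a : ℝ}
    (hM : ∀ h, Reach sel h → step env Xcand sel M h ≤ M h + a) (n : ℕ) :
    processExpect env Xcand sel n M ≤ M [] + n * a := by
  induction n with
  | zero => simp [processExpect]
  | succ n ih =>
    rw [processExpect_succ]
    have h1 : processExpect env Xcand sel n (step env Xcand sel M) ≤
        processExpect env Xcand sel n (M + fun _ => a) :=
      processExpect_mono fun h hr _ => hM h hr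
    rw [map_add, processExpect_const I hsel] at h1
    push_cast
    linarith

lemma processExpect_pathSum_le {F : History m → ℝ} {a : ℝ} {n : ℕ}
    (hF : ∀ t ≤ n, processExpect env Xcand sel t F ≤ a) :
    processExpect env Xcand sel n (pathSum F) ≤ (n + 1) * a := by
  induction n with
  | zero => simpa [processExpect, pathSum] using hF 0 le_rfl
  | succ n ih =>
    have h1 := ih fun t ht => hF t (by omega)
    have h2 := hF (n + 1) le_rfl
    have h3 : processExpect env Xcand sel (n + 1) (pathSum F) ≤
        processExpect env Xcand sel n (step env Xcand sel F + pathSum F) := by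
      rw [processExpect_succ]
      refine processExpect_mono fun h hr _ => ?_
      simp only [step_apply, pathSum, cellExpect_add, Pi.add_apply]
      rw [I.cellExpect_const (hsel h hr)]
    rw [map_add, ← processExpect_succ] at h3
    push_cast
    linarith

/-- The tower rule: in expectation, the realized utility of a round may be replaced by the
expected utility of the chosen cell. -/
lemma expectedUtility_eq (n : ℕ) : ∀ h, Reach sel h →
    expectedUtility env Xcand sel n h + (h.map fun r => env.cellUtility Xcand r.cell).sum =
      (step env Xcand sel ^ n)
        (fun h => (h.map fun r => env.cellUtility Xcand r.cell).sum) h := by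
  induction n with
  | zero => intro h _; simp [expectedUtility]
  | succ n ih =>
    intro h hr
    rw [pow_succ', Module.End.mul_apply, step_apply]
    have hf := hsel h hr
    have h1 : ∀ b π, (step env Xcand sel ^ n)
        (fun h => (h.map fun r => env.cellUtility Xcand r.cell).sum) (⟨sel h, b, π⟩ :: h) =
        expectedUtility env Xcand sel n (⟨sel h, b, π⟩ :: h) +
          (env.cellUtility Xcand (sel h) + (h.map fun r => env.cellUtility Xcand r.cell).sum) := by
      intro b π
      rw [← ih _ (.cons h b π hr)]
      simp
    simp only [h1]
    rw [cellExpect_add, I.cellExpect_const hf]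
    have h2 : expectedUtility env Xcand sel (n + 1) h =
        cellExpect env Xcand (sel h) (fun b π => (env.value π - pay ((sel h).anchor Xcand b) π) +
          expectedUtility env Xcand sel n (⟨sel h, b, π⟩ :: h)) := by
      rw [expectedUtility]
      unfold cellExpect
      refine Finset.sum_congr rfl fun b _ => ?_
      rw [env.expect_eq_sum (I.anchor_weaklyBounded hf b)]
    rw [h2, cellExpect_add, ← I.cellUtility_eq_cellExpect hf]
    ring

/-- The regret is the expected sum of the badnesses of the chosen cells. -/
lemma regret_eq (T : ℕ) : regret env Xcand T sel = processExpect env Xcand sel T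
    (fun h => (h.map fun r => env.opt Xcand - env.cellUtility Xcand r.cell).sum) := by
  have h1 := expectedUtility_eq I hsel T [] .nil
  simp only [List.map_nil, List.sum_nil, add_zero] at h1
  have h2 : processExpect env Xcand sel T
      (fun h => (h.map fun r => env.opt Xcand - env.cellUtility Xcand r.cell).sum) =
      processExpect env Xcand sel T ((fun _ => T * env.opt Xcand) -
        fun h => (h.map fun r => env.cellUtility Xcand r.cell).sum) := by
    refine le_antisymm ?_ ?_ <;>
    · refine processExpect_mono fun h _ hl => ?_
      rw [Pi.sub_apply, sum_map_const_sub, hl]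
  rw [h2, map_sub, processExpect_const I hsel, regret, h1]
  rfl

end

end Averaging

/-! ### Uniform concentration along the play -/

section Concentration

variable {m : ℕ} {Θ E : Type*} [MeasurableSpace Θ] (env : Environment m Θ E)
  (Xcand : Set (Contract m))

/-- A centred observable of the rounds in which a cell is chosen: `val C coin outcome` is observed
in those rounds whose coin is `counts`, and its exponential moments under the law of one round are
those of a centred variable with values in an interval of length one. -/
structure Observable where
  /-- The centred observation. -/
  val : Cell m → Bool → Fin (m + 1) → ℝ
  /-- The coins of the rounds in which the observation is made. -/
  counts : Bool → Bool
  val_eq_zero : ∀ C b π, counts b = false → val C b π = 0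
  exp_le : ∀ C : Cell m, C.Feasible Xcand → ∀ t : ℝ,
    cellExpect env Xcand C
      (fun b π => Real.exp (t * val C b π - if counts b then t ^ 2 / 8 else 0)) ≤ 1

namespace Observable

variable {env Xcand} (Y : Observable env Xcand) {sel : History m → Cell m}

/-- The sum of the observations of cell `C`. -/
noncomputable def sum (h : History m) (C : Cell m) : ℝ :=
  ((roundsIn h C).map fun r => Y.val C r.coin r.outcome).sum

/-- The number of observations of cell `C`. -/
noncomputable def count (h : History m) (C : Cell m) : ℕ :=
  ((roundsIn h C).filter fun r => Y.counts r.coin).length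

/-- The exponential supermartingale of cell `C`. -/
noncomputable def expSum (t : ℝ) (h : History m) (C : Cell m) : ℝ :=
  Real.exp (t * Y.sum h C - t ^ 2 / 8 * Y.count h C)

open Classical in
/-- The sum of the exponential supermartingales of all cells chosen so far. -/
noncomputable def totalExpSum (t : ℝ) (h : History m) : ℝ :=
  ∑ C ∈ (h.map Round.cell).toFinset, Y.expSum t h C

/-- All sums of observations are within the confidence bound for the horizon `T`: the constant is
chosen so that the moment bound gives probability at most `2 T⁻⁴` to a deviation beyond it at a given
number of observations. -/
def Concentrated (T : ℕ) (h : History m) : Prop :=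
  ∀ C, Y.sum h C ^ 2 ≤ 2 * Y.count h C * Real.log T

/-- A nonnegative function of the history that is at least one where concentration fails and has
small expectation. -/
noncomputable def failureBound (T : ℕ) (h : History m) : ℝ :=
  ∑ N ∈ Finset.Icc 1 T, ((T : ℝ) ^ 4)⁻¹ *
    (Y.totalExpSum (Real.sqrt (32 * Real.log T / N)) h +
      Y.totalExpSum (-Real.sqrt (32 * Real.log T / N)) h)

lemma roundsIn_cons_self (r : Round m) (h : History m) :
    roundsIn (r :: h) r.cell = r :: roundsIn h r.cell := by
  simp [roundsIn]

lemma roundsIn_cons_of_ne {r : Round m} {h : History m} {C : Cell m} (hC : C ≠ r.cell) :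
    roundsIn (r :: h) C = roundsIn h C := by
  simp [roundsIn, Ne.symm hC]

lemma roundsIn_eq_nil {h : History m} {C : Cell m} (hC : C ∉ h.map Round.cell) :
    roundsIn h C = [] := by
  simp only [roundsIn, List.filter_eq_nil_iff]
  intro r hr h1
  exact hC (List.mem_map.2 ⟨r, hr, by simpa using h1⟩)

lemma expSum_cons_of_ne {t : ℝ} {r : Round m} {h : History m} {C : Cell m} (hC : C ≠ r.cell) :
    Y.expSum t (r :: h) C = Y.expSum t h C := by
  simp only [expSum, sum, count, roundsIn_cons_of_ne hC]

lemma expSum_cons_self (t : ℝ) (r : Round m) (h : History m) :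
    Y.expSum t (r :: h) r.cell = Y.expSum t h r.cell *
      Real.exp (t * Y.val r.cell r.coin r.outcome - if Y.counts r.coin then t ^ 2 / 8 else 0) := by
  rw [expSum, expSum, ← Real.exp_add]
  congr 1
  simp only [sum, count, roundsIn_cons_self, List.map_cons, List.sum_cons, List.filter_cons]
  by_cases hc : Y.counts r.coin = true
  · simp only [hc, if_true, List.length_cons]
    push_cast
    ring
  · simp only [hc]
    simp
    ring

lemma expSum_of_notMem {t : ℝ} {h : History m} {C : Cell m} (hC : C ∉ h.map Round.cell) :
    Y.expSum t h C = 1 := by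
  simp [expSum, sum, count, roundsIn_eq_nil hC]

lemma totalExpSum_nonneg (t : ℝ) (h : History m) : 0 ≤ Y.totalExpSum t h :=
  Finset.sum_nonneg fun _ _ => (Real.exp_pos _).le

lemma failureBound_nonneg (T : ℕ) (h : History m) : 0 ≤ Y.failureBound T h :=
  Finset.sum_nonneg fun _ _ => mul_nonneg (by positivity)
    (add_nonneg (Y.totalExpSum_nonneg _ _) (Y.totalExpSum_nonneg _ _))

/-- In one round the total grows by at most `1` in expectation: the summand of the chosen cell is a
supermartingale, and a cell chosen for the first time adds a summand that starts at `1`. This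
avoids a union bound over the infinitely many possible cells. -/
lemma step_totalExpSum_le (I : Instance env Xcand)
    (hsel : ∀ h, Reach sel h → (sel h).Feasible Xcand) (t : ℝ) (h : History m)
    (hr : Reach sel h) :
    step env Xcand sel (Y.totalExpSum t) h ≤ Y.totalExpSum t h + 1 := by
  classical
  set S := (h.map Round.cell).toFinset with hS
  have h1 : ∀ b π, Y.totalExpSum t (⟨sel h, b, π⟩ :: h) =
      ∑ C ∈ S.erase (sel h), Y.expSum t h C + Y.expSum t h (sel h) *
        Real.exp (t * Y.val (sel h) b π - if Y.counts b then t ^ 2 / 8 else 0) := by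
    intro b π
    have h2 : (((⟨sel h, b, π⟩ : Round m) :: h).map Round.cell).toFinset =
        insert (sel h) (S.erase (sel h)) := by
      ext D
      by_cases hD : D = sel h <;> simp [hS, hD]
    rw [totalExpSum, h2, Finset.sum_insert (Finset.notMem_erase _ _), add_comm]
    congr 1
    · refine Finset.sum_congr rfl fun C hC => ?_
      exact Y.expSum_cons_of_ne (r := ⟨sel h, b, π⟩) (Finset.ne_of_mem_erase hC)
    · exact Y.expSum_cons_self t ⟨sel h, b, π⟩ h
  rw [step_apply]
  simp only [h1]
  rw [cellExpect_add, I.cellExpect_const (hsel h hr), cellExpect_const_mul]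
  have h3 := mul_le_mul_of_nonneg_left (Y.exp_le (sel h) (hsel h hr) t)
    (Real.exp_pos (t * Y.sum h (sel h) - t ^ 2 / 8 * Y.count h (sel h))).le
  rw [mul_one] at h3
  have h4 : ∑ C ∈ S.erase (sel h), Y.expSum t h C + Y.expSum t h (sel h) ≤
      Y.totalExpSum t h + 1 := by
    by_cases hm : sel h ∈ S
    · rw [Finset.sum_erase_add _ _ hm, totalExpSum]
      linarith
    · rw [Finset.erase_eq_of_notMem hm, Y.expSum_of_notMem (by simpa [hS] using hm), totalExpSum]
  unfold expSum at *
  linarith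

lemma count_le_length (h : History m) (C : Cell m) : Y.count h C ≤ h.length :=
  (List.length_filter_le _ _).trans (by unfold roundsIn; exact List.length_filter_le _ _)

lemma sum_eq_zero_of_count {h : History m} {C : Cell m} (h0 : Y.count h C = 0) :
    Y.sum h C = 0 := by
  rw [count, List.length_eq_zero_iff, List.filter_eq_nil_iff] at h0
  refine List.sum_eq_zero fun x hx => ?_
  obtain ⟨r, hr, rfl⟩ := List.mem_map.1 hx
  exact Y.val_eq_zero _ _ _ (by simpa using h0 r hr)

lemma one_le_failureBound {T : ℕ} (hT : 2 ≤ T) {h : History m} (hl : h.length ≤ T)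
    (hc : ¬ Y.Concentrated T h) : 1 ≤ Y.failureBound T h := by
  classical
  simp only [Concentrated, not_forall, not_le] at hc
  obtain ⟨C, hC⟩ := hc
  have hL : 0 < Real.log T := Real.log_pos (by exact_mod_cast hT)
  have hT0 : (0 : ℝ) < T := by positivity
  set N := Y.count h C with hN
  have hN0 : N ≠ 0 := by
    intro h0
    rw [Y.sum_eq_zero_of_count h0, h0] at hC
    simp at hC
  have hNpos : (0 : ℝ) < N := by exact_mod_cast Nat.pos_of_ne_zero hN0
  have hmem : C ∈ (h.map Round.cell).toFinset := by
    by_contra hm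
    apply hN0
    rw [List.mem_toFinset] at hm
    simp [hN, count, roundsIn_eq_nil hm]
  set t := Real.sqrt (32 * Real.log T / N) with ht
  have ht2 : t ^ 2 = 32 * Real.log T / N := Real.sq_sqrt (by positivity)
  have ht0 : 0 ≤ t := Real.sqrt_nonneg _
  -- With this `t` the exponent of the supermartingale exceeds `4 log T` as soon as the deviation
  -- is larger than `√(2 N log T)`.
  have hdev : 8 * Real.log T ≤ t * |Y.sum h C| := by
    refine (pow_le_pow_iff_left₀ (by positivity) (by positivity) two_ne_zero).1 ?_
    rw [mul_pow t, sq_abs, ht2]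
    have : (8 * Real.log T) ^ 2 = 32 * Real.log T / N * (2 * N * Real.log T) := by
      field_simp; norm_num
    rw [this]
    exact mul_le_mul_of_nonneg_left hC.le (by positivity)
  have hbig : (T : ℝ) ^ 4 ≤ Y.totalExpSum t h + Y.totalExpSum (-t) h := by
    have h4 : (T : ℝ) ^ 4 = Real.exp (4 * Real.log T) := by
      rw [mul_comm, Real.exp_mul, Real.exp_log hT0]; norm_cast
    have hq : t ^ 2 / 8 * N = 4 * Real.log T := by rw [ht2]; field_simp; norm_num
    have hle : ∀ u, Y.expSum u h C ≤ Y.totalExpSum u h := fun u =>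
      Finset.single_le_sum (f := fun C => Y.expSum u h C) (fun _ _ => (Real.exp_pos _).le) hmem
    rcases le_total 0 (Y.sum h C) with h0 | h0
    · rw [abs_of_nonneg h0] at hdev
      have : (T : ℝ) ^ 4 ≤ Y.expSum t h C := by
        rw [h4, expSum, ← hN, hq]
        exact Real.exp_le_exp.2 (by linarith)
      linarith [hle t, Y.totalExpSum_nonneg (-t) h]
    · rw [abs_of_nonpos h0] at hdev
      have : (T : ℝ) ^ 4 ≤ Y.expSum (-t) h C := by
        rw [h4, expSum, ← hN, neg_sq, hq]
        exact Real.exp_le_exp.2 (by linarith)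
      linarith [hle (-t), Y.totalExpSum_nonneg t h]
  have hNT : N ∈ Finset.Icc 1 T :=
    Finset.mem_Icc.2 ⟨Nat.one_le_iff_ne_zero.2 hN0, (Y.count_le_length h C).trans hl⟩
  have h5 : (1 : ℝ) ≤ ((T : ℝ) ^ 4)⁻¹ * (Y.totalExpSum t h + Y.totalExpSum (-t) h) := by
    rw [← div_eq_inv_mul, one_le_div (by positivity)]
    exact hbig
  exact h5.trans (Finset.single_le_sum (f := fun N : ℕ => ((T : ℝ) ^ 4)⁻¹ *
    (Y.totalExpSum (Real.sqrt (32 * Real.log T / N)) h +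
      Y.totalExpSum (-Real.sqrt (32 * Real.log T / N)) h))
    (fun _ _ => mul_nonneg (by positivity)
      (add_nonneg (Y.totalExpSum_nonneg _ _) (Y.totalExpSum_nonneg _ _))) hNT)

lemma processExpect_failureBound_le (I : Instance env Xcand)
    (hsel : ∀ h, Reach sel h → (sel h).Feasible Xcand) {T n : ℕ} (hT : 2 ≤ T) (hn : n ≤ T) :
    processExpect env Xcand sel n (Y.failureBound T) ≤ 2 / (T : ℝ) ^ 2 := by
  have hT0 : (0 : ℝ) < T := by positivity
  have h1 : ∀ t, processExpect env Xcand sel n (Y.totalExpSum t) ≤ T := by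
    intro t
    have := processExpect_le_of_step_le I hsel (Y.step_totalExpSum_le I hsel t) n
    have h0 : Y.totalExpSum t [] = 0 := by simp [totalExpSum]
    rw [h0] at this
    have : (n : ℝ) ≤ T := by exact_mod_cast hn
    linarith
  have h2 : Y.failureBound (m := m) T = ∑ N ∈ Finset.Icc 1 T, ((T : ℝ) ^ 4)⁻¹ •
      (Y.totalExpSum (Real.sqrt (32 * Real.log T / N)) +
        Y.totalExpSum (-Real.sqrt (32 * Real.log T / N))) := by
    ext h
    simp [failureBound, Finset.sum_apply, mul_add]
  rw [h2, map_sum]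
  refine (Finset.sum_le_card_nsmul _ _ (((T : ℝ) ^ 4)⁻¹ * (T + T)) ?_).trans (le_of_eq ?_)
  · intro N _
    rw [map_smul, map_add, smul_eq_mul]
    exact mul_le_mul_of_nonneg_left (add_le_add (h1 _) (h1 _)) (by positivity)
  · rw [Nat.card_Icc, nsmul_eq_mul]
    simp
    field_simp
    ring

end Observable

/-- A bound on the sum of the badnesses of the chosen cells that holds whenever finitely many
observables are concentrated throughout the play bounds the regret up to a constant. -/
lemma regret_le_of_concentrated {env : Environment m Θ E} {Xcand : Set (Contract m)}
    {sel : History m → Cell m} (I : Instance env Xcand)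
    (hsel : ∀ h, Reach sel h → (sel h).Feasible Xcand)
    {ι : Type*} [Fintype ι] (Y : ι → Observable env Xcand) {T : ℕ} (hT : 2 ≤ T)
    {A B : ℝ} (hA : 0 ≤ A) (hB : 0 ≤ B)
    (hall : ∀ C : Cell m, C.Feasible Xcand → env.opt Xcand - env.cellUtility Xcand C ≤ A)
    (hgood : ∀ h, Reach sel h → h.length = T →
      AlongPath (fun h => ∀ i, (Y i).Concentrated T h) h →
      (h.map fun r => env.opt Xcand - env.cellUtility Xcand r.cell).sum ≤ B) :
    regret env Xcand T sel ≤ B + 4 * Fintype.card ι * A := by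
  have hT0 : (0 : ℝ) < T := by positivity
  -- The `T + 1` initial segments fail with total probability `O(1 / T)`, which cancels against the
  -- worst-case regret `T * A`.
  set F : History m → ℝ := ∑ i, (Y i).failureBound T with hF
  have hF0 : ∀ h, 0 ≤ F h := fun h => by
    rw [hF, Finset.sum_apply]
    exact Finset.sum_nonneg fun i _ => (Y i).failureBound_nonneg T h
  have h1 : ∀ h, Reach sel h → (h.map fun r => env.opt Xcand -
      env.cellUtility Xcand r.cell).sum ≤ h.length * A := by
    intro h hr
    induction hr with
    | nil => simp
    | cons h b π hr ih =>
      simp only [List.map_cons, List.sum_cons, List.length_cons]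
      push_cast
      linarith [hall _ (hsel h hr)]
  have h2 : ∀ h, h.length ≤ T → ¬ (∀ i, (Y i).Concentrated T h) → 1 ≤ F h := by
    intro h hl hc
    obtain ⟨i, hi⟩ := not_forall.1 hc
    rw [hF, Finset.sum_apply]
    exact ((Y i).one_le_failureBound hT hl hi).trans (Finset.single_le_sum
      (f := fun i => (Y i).failureBound T h)
      (fun j _ => (Y j).failureBound_nonneg T h) (Finset.mem_univ i))
  have h3 : regret env Xcand T sel ≤ processExpect env Xcand sel T
      ((fun _ => B) + (T * A) • pathSum F) := by
    rw [regret_eq I hsel]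
    refine processExpect_mono fun h hr hl => ?_
    simp only [Pi.add_apply, Pi.smul_apply, smul_eq_mul]
    by_cases hp : AlongPath (fun h => ∀ i, (Y i).Concentrated T h) h
    · have := hgood h hr hl hp
      have : 0 ≤ T * A * pathSum F h := mul_nonneg (by positivity) (pathSum_nonneg hF0 h)
      linarith
    · have h4 := one_le_pathSum (n := T) hF0 h2 hl.le hp
      have h5 := h1 h hr
      rw [hl] at h5
      have : T * A * 1 ≤ T * A * pathSum F h := mul_le_mul_of_nonneg_left h4 (by positivity)
      linarith
  have h4 : processExpect env Xcand sel T (pathSum F) ≤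
      (T + 1) * (Fintype.card ι * (2 / (T : ℝ) ^ 2)) := by
    refine processExpect_pathSum_le I hsel fun t ht => ?_
    rw [hF, map_sum]
    refine (Finset.sum_le_card_nsmul _ _ (2 / (T : ℝ) ^ 2) fun i _ =>
      (Y i).processExpect_failureBound_le I hsel hT ht).trans (le_of_eq ?_)
    simp
  rw [map_add, map_smul, processExpect_const I hsel, smul_eq_mul] at h3
  have h5 : T * A * processExpect env Xcand sel T (pathSum F) ≤ 4 * Fintype.card ι * A := by
    refine (mul_le_mul_of_nonneg_left h4 (by positivity)).trans ?_
    have h6 : T * A * ((T + 1) * (Fintype.card ι * (2 / (T : ℝ) ^ 2))) =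
        2 * Fintype.card ι * A * ((T + 1) / T) := by field_simp
    have h7 : ((T : ℝ) + 1) / T ≤ 2 := by
      rw [div_le_iff₀ hT0]
      have : (2 : ℝ) ≤ T := by exact_mod_cast hT
      linarith
    rw [h6]
    have : 0 ≤ 2 * Fintype.card ι * A := by positivity
    nlinarith
  linarith

end Concentration

/-! ### The observed statistics -/

section Averages

variable {α : Type*}

lemma average_map_mem {l : List α} {f : α → ℝ} {B : ℝ} (hB : 0 ≤ B)
    (h : ∀ r ∈ l, 0 ≤ f r ∧ f r ≤ B) : 0 ≤ average (l.map f) ∧ average (l.map f) ≤ B := by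
  unfold average
  rw [List.length_map]
  have h0 : 0 ≤ (l.map f).sum :=
    List.sum_nonneg fun x hx => by obtain ⟨r, hr, rfl⟩ := List.mem_map.1 hx; exact (h r hr).1
  have h1 : (l.map f).sum ≤ l.length * B := by
    have := List.sum_le_card_nsmul (l.map f) B
      fun x hx => by obtain ⟨r, hr, rfl⟩ := List.mem_map.1 hx; exact (h r hr).2
    simpa using this
  refine ⟨by positivity, ?_⟩
  rcases Nat.eq_zero_or_pos l.length with hl | hl
  · simp [hl, hB]
  · rw [div_le_iff₀ (by exact_mod_cast hl)]
    linarith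

lemma average_map_mono {l : List α} {f g : α → ℝ} (h : ∀ r ∈ l, f r ≤ g r) :
    average (l.map f) ≤ average (l.map g) := by
  unfold average
  rw [List.length_map, List.length_map]
  exact div_le_div_of_nonneg_right (List.sum_le_sum h) (by positivity)

lemma average_map_mul_length (l : List α) (f : α → ℝ) :
    average (l.map f) * l.length = (l.map f).sum := by
  unfold average
  rw [List.length_map]
  rcases eq_or_ne l [] with rfl | hl
  · simp
  · have : (l.length : ℝ) ≠ 0 := by simpa using hl
    field_simp

/-- A deviation bound for a sum, as a deviation bound for the average over at least `n / 4`
terms. -/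
lemma abs_average_sub_le {l : List α} {f : α → ℝ} {μ L n : ℝ} (hn : 0 < n)
    (hl : n / 4 ≤ l.length)
    (h : ((l.map f).sum - l.length * μ) ^ 2 ≤ 2 * l.length * L) :
    |average (l.map f) - μ| ≤ Real.sqrt (8 * L / n) := by
  have hl0 : (0 : ℝ) < l.length := by linarith
  refine Real.abs_le_sqrt ?_
  rw [← average_map_mul_length, mul_comm _ (l.length : ℝ), ← mul_sub, mul_pow] at h
  rw [le_div_iff₀ hn]
  have h1 : (l.length : ℝ) * (average (l.map f) - μ) ^ 2 ≤ 2 * L := by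
    refine le_of_mul_le_mul_left ?_ hl0
    nlinarith
  nlinarith [sq_nonneg (average (l.map f) - μ)]

lemma sum_map_div (l : List α) (f : α → ℝ) (s : ℝ) :
    (l.map fun a => f a / s).sum = (l.map f).sum / s := by
  induction l with
  | nil => simp
  | cons a l ih => simp only [List.map_cons, List.sum_cons, ih]; ring

lemma average_map_div (l : List α) (f : α → ℝ) (s : ℝ) :
    average (l.map fun a => f a / s) = average (l.map f) / s := by
  simp only [average, sum_map_div, List.length_map]
  ring

end Averages

namespace Observable

variable {m : ℕ} {Θ E : Type*} [MeasurableSpace Θ] {env : Environment m Θ E}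
  {Xcand : Set (Contract m)}

/-- The observable given by a function with values in `[0,1]` of the outcome of the rounds with
coin `b₀`. -/
noncomputable def ofCoin (I : Instance env Xcand) (b₀ : Bool) (g : Cell m → Fin (m + 1) → ℝ)
    (hg : ∀ C : Cell m, C.Feasible Xcand → ∀ π, 0 ≤ g C π ∧ g C π ≤ 1) :
    Observable env Xcand where
  val C b π := if b = b₀ then g C π - env.expect (C.anchor Xcand b₀) (g C) else 0
  counts b := decide (b = b₀)
  val_eq_zero C b π hb := if_neg (by simpa using hb)
  exp_le C hC t := by
    have h1 : ∀ b, ∑ π, env.outcomeProb (C.anchor Xcand b) π *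
        Real.exp (t * (if b = b₀ then g C π - env.expect (C.anchor Xcand b₀) (g C) else 0) -
          if decide (b = b₀) = true then t ^ 2 / 8 else 0) ≤ 1 := by
      intro b
      have hw := I.anchor_weaklyBounded hC b
      by_cases hb : b = b₀
      · subst hb
        simp only [if_true, decide_true]
        have h := sum_mul_exp_le_of_mem_Icc (env.outcomeProb_nonneg _) (env.outcomeProb_sum hw)
          (hg C hC) t
        rw [← env.expect_eq_sum hw (g C)] at h
        simp only [Real.exp_sub, ← mul_div_assoc, ← Finset.sum_div]
        rw [div_le_one (Real.exp_pos _)]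
        exact h
      · simp [hb, env.outcomeProb_sum hw]
    unfold cellExpect
    simp only [Fintype.sum_bool]
    linarith [h1 true, h1 false]

/-- The observable given by a function with values in `[0,1]` of the coin and the outcome. -/
noncomputable def ofBoth (I : Instance env Xcand) (g : Cell m → Bool → Fin (m + 1) → ℝ)
    (hg : ∀ C : Cell m, C.Feasible Xcand → ∀ b π, 0 ≤ g C b π ∧ g C b π ≤ 1) :
    Observable env Xcand where
  val C b π := g C b π - cellExpect env Xcand C (g C)
  counts _ := true
  val_eq_zero C b π hb := by simp at hb
  exp_le C hC t := by
    have hpair : ∀ f : Bool → Fin (m + 1) → ℝ, cellExpect env Xcand C f =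
        ∑ a : Bool × Fin (m + 1), (1 / 2 * env.outcomeProb (C.anchor Xcand a.1) a.2) *
          f a.1 a.2 := by
      intro f
      rw [Fintype.sum_prod_type]
      simp only [cellExpect, Finset.mul_sum, mul_assoc]
    have h := sum_mul_exp_le_of_mem_Icc
      (q := fun a : Bool × Fin (m + 1) => 1 / 2 * env.outcomeProb (C.anchor Xcand a.1) a.2)
      (g := fun a => g C a.1 a.2)
      (fun a => mul_nonneg (by norm_num) (env.outcomeProb_nonneg _ _))
      (by
        have := hpair fun _ _ => 1
        rw [I.cellExpect_const hC] at this
        simpa using this.symm)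
      (fun a => hg C hC a.1 a.2) t
    rw [← hpair (g C)] at h
    rw [hpair]
    simp only [if_true, Real.exp_sub, ← mul_div_assoc, ← Finset.sum_div]
    rw [div_le_one (Real.exp_pos _)]
    exact h

variable (I : Instance env Xcand)

lemma count_ofCoin (b₀ : Bool) (g : Cell m → Fin (m + 1) → ℝ) (hg) (h : History m) (C : Cell m) :
    (ofCoin I b₀ g hg).count h C = (roundsAt h C b₀).length := rfl

lemma sum_ofCoin (b₀ : Bool) (g : Cell m → Fin (m + 1) → ℝ) (hg) (h : History m) (C : Cell m) :
    (ofCoin I b₀ g hg).sum h C = ((roundsAt h C b₀).map fun r => g C r.outcome).sum -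
      (roundsAt h C b₀).length * env.expect (C.anchor Xcand b₀) (g C) := by
  unfold Observable.sum roundsAt ofCoin
  induction roundsIn h C with
  | nil => simp
  | cons r l ih =>
    by_cases hr : r.coin = b₀
    · simp only [List.map_cons, List.sum_cons, ih, hr, if_true, decide_true,
        List.filter_cons_of_pos, List.length_cons]
      push_cast
      ring
    · simp only [List.map_cons, List.sum_cons, ih, hr, if_false, decide_false, zero_add,
        Bool.false_eq_true, not_false_eq_true, List.filter_cons_of_neg]

lemma count_ofBoth (g : Cell m → Bool → Fin (m + 1) → ℝ) (hg) (h : History m) (C : Cell m) :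
    (ofBoth I g hg).count h C = numPlays h C := by
  simp [count, ofBoth, numPlays]

lemma sum_ofBoth (g : Cell m → Bool → Fin (m + 1) → ℝ) (hg) (h : History m) (C : Cell m) :
    (ofBoth I g hg).sum h C = ((roundsIn h C).map fun r => g C r.coin r.outcome).sum -
      numPlays h C * cellExpect env Xcand C (g C) := by
  unfold Observable.sum numPlays ofBoth
  induction roundsIn h C with
  | nil => simp
  | cons r l ih =>
    simp only [List.map_cons, List.sum_cons, ih, List.length_cons]
    push_cast
    ring

/-- The value of the outcome, in the rounds with coin `b`. -/
noncomputable def value (b : Bool) : Observable env Xcand :=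
  ofCoin I b (fun _ => env.value) fun _ _ π => ⟨env.value_nonneg π, env.value_le_one π⟩

/-- The payment that the minimal corner specifies for the outcome, in the rounds with
coin `b`. -/
noncomputable def minPay (b : Bool) : Observable env Xcand :=
  ofCoin I b (fun C => pay C.minCorner) fun _ hC π =>
    ⟨hC.pay_nonneg (Cell.minCorner_mem hC.side_pos.le) π, I.pay_minCorner_le hC π⟩

/-- The payment that the maximal corner specifies for the outcome, normalized to `[0,1]`, in the
rounds in which the maximal corner is posted. -/
noncomputable def maxPay : Observable env Xcand :=
  ofCoin I true (fun C π => pay C.maxCorner π / (1 + m * C.side)) fun C hC π => by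
    have := hC.side_pos
    exact ⟨div_nonneg (hC.pay_nonneg (Cell.maxCorner_mem hC.side_pos.le) π) (by positivity),
      (div_le_one (by positivity)).2 (I.pay_maxCorner_le hC π)⟩

/-- The coin. -/
noncomputable def coin : Observable env Xcand :=
  ofBoth I (fun _ b _ => if b = true then 1 else 0) fun _ _ b _ => by split_ifs <;> norm_num

/-- The utility of the requester, normalized to `[0,1]`. -/
noncomputable def utility : Observable env Xcand :=
  ofBoth I (fun C b π => (env.value π - pay (C.anchor Xcand b) π + (C.utilityRange Xcand - 1)) /
    C.utilityRange Xcand) fun C hC b π => by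
    have h1 := hC.two_le_utilityRange
    have h2 := I.pay_anchor_le hC b π
    have h3 := hC.pay_nonneg (I.anchor_mem hC b) π
    have h4 := env.value_nonneg π
    have h5 := env.value_le_one π
    exact ⟨div_nonneg (by linarith) (by linarith), (div_le_one (by linarith)).2 (by linarith)⟩

/-- The observables on whose concentration the analysis rests. -/
noncomputable def family : Fin 7 → Observable env Xcand :=
  ![value I true, value I false, minPay I true, minPay I false, maxPay I, coin I, utility I]

end Observable

section Statistics

variable {m : ℕ} {Θ E : Type*} [MeasurableSpace Θ] {env : Environment m Θ E}
  {Xcand : Set (Contract m)} {I : Instance env Xcand} {c : ℝ} {T : ℕ} {h : History m} {C : Cell m}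

lemma mem_roundsIn {r : Round m} : r ∈ roundsIn h C ↔ r ∈ h ∧ r.cell = C := by
  simp [roundsIn]

lemma mem_roundsAt {r : Round m} {b : Bool} :
    r ∈ roundsAt h C b ↔ r ∈ h ∧ r.cell = C ∧ r.coin = b := by
  simp [roundsAt, mem_roundsIn, and_assoc]

lemma avgPayment_eq (b : Bool) : avgPayment Xcand h C b =
    average ((roundsAt h C b).map fun r => pay (C.anchor Xcand b) r.outcome) := by
  unfold avgPayment
  congr 1
  refine List.map_congr_left fun r hr => ?_
  obtain ⟨_, h1, h2⟩ := mem_roundsAt.1 hr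
  rw [posted, h1, h2]

lemma length_roundsAt_add : (roundsAt h C true).length + (roundsAt h C false).length =
    numPlays h C := by
  unfold roundsAt numPlays
  induction roundsIn h C with
  | nil => rfl
  | cons r l ih =>
    cases hb : r.coin <;> simp [hb] at ih ⊢ <;> omega

/-- The utility average in terms of the averages for the two anchors. -/
lemma avgUtility_mul : avgUtility env Xcand h C * numPlays h C =
    (avgValue env h C true - avgPayment Xcand h C true) * (roundsAt h C true).length +
    (avgValue env h C false - avgPayment Xcand h C false) * (roundsAt h C false).length := by
  unfold avgUtility avgValue avgPayment numPlays
  rw [average_map_mul_length, sub_mul, sub_mul]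
  simp only [average_map_mul_length]
  unfold roundsAt
  induction roundsIn h C with
  | nil => simp
  | cons r l ih =>
    cases hb : r.coin <;> simp [hb] at ih ⊢ <;> linarith

lemma avgUtility_eq : avgUtility env Xcand h C = average ((roundsIn h C).map fun r =>
    env.value r.outcome - pay (C.anchor Xcand r.coin) r.outcome) := by
  unfold avgUtility
  congr 1
  refine List.map_congr_left fun r hr => ?_
  rw [posted, (mem_roundsIn.1 hr).2]

lemma avgValue_mem (b : Bool) : 0 ≤ avgValue env h C b ∧ avgValue env h C b ≤ 1 :=
  average_map_mem zero_le_one fun _ _ => ⟨env.value_nonneg _, env.value_le_one _⟩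

lemma avgPayment_false_mem (I : Instance env Xcand) (hC : C.Feasible Xcand)
    (hc : C.Composite Xcand) :
    0 ≤ avgPayment Xcand h C false ∧ avgPayment Xcand h C false ≤ 1 := by
  rw [avgPayment_eq, Cell.anchor_false hc]
  exact average_map_mem zero_le_one fun r _ =>
    ⟨hC.pay_nonneg (Cell.minCorner_mem hC.side_pos.le) _, I.pay_minCorner_le hC _⟩

lemma avgPayment_true_mem (I : Instance env Xcand) (hC : C.Feasible Xcand)
    (hc : C.Composite Xcand) :
    0 ≤ avgPayment Xcand h C true ∧ avgPayment Xcand h C true ≤ 1 + m * C.side := by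
  rw [avgPayment_eq, Cell.anchor_true hc]
  have := hC.side_pos
  exact average_map_mem (by positivity) fun r _ =>
    ⟨hC.pay_nonneg (Cell.maxCorner_mem hC.side_pos.le) _, I.pay_maxCorner_le hC _⟩

/-- The scale of the deviations of averages over at least a quarter of the rounds in which `C` was
chosen. -/
noncomputable def deviation (T : ℕ) (h : History m) (C : Cell m) : ℝ :=
  Real.sqrt (8 * Real.log T / numPlays h C)

lemma deviation_nonneg : 0 ≤ deviation T h C := Real.sqrt_nonneg _

lemma confRad_nonneg : 0 ≤ confRad c T h C := Real.sqrt_nonneg _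

/-- For `c ≥ 16` the confidence radius is at least `√2` times the deviation scale. -/
lemma seven_mul_deviation_le (hc : 16 ≤ c) (hT : 18 ≤ T) :
    7 * deviation T h C ≤ 5 * confRad c T h C := by
  have hL : 0 < Real.log T := Real.log_pos (by exact_mod_cast (by omega : 1 < T))
  refine (pow_le_pow_iff_left₀ (mul_nonneg (by norm_num) deviation_nonneg)
    (mul_nonneg (by norm_num) confRad_nonneg) two_ne_zero).1 ?_
  rw [mul_pow, mul_pow, deviation, confRad, Real.sq_sqrt (by positivity),
    Real.sq_sqrt (by positivity), ← mul_div_assoc, ← mul_div_assoc]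
  refine div_le_div_of_nonneg_right ?_ (by positivity)
  nlinarith

lemma one_le_log (hT : 18 ≤ T) : 1 ≤ Real.log T := by
  rw [Real.le_log_iff_exp_le (by positivity)]
  have : (18 : ℝ) ≤ T := by exact_mod_cast hT
  linarith [Real.exp_one_lt_d9]

/-- As long as a cell has been chosen fewer than `32 log T` times, its confidence radius dominates
all quantities of order one, so that no concentration is needed. -/
lemma confRad_large (hc : 16 ≤ c) (hT : 18 ≤ T) (hn : numPlays h C ≠ 0)
    (hs : (numPlays h C : ℝ) < 32 * Real.log T) : 7 / 2 ≤ 5 * confRad c T h C := by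
  have hL := one_le_log hT
  have hn0 : (0 : ℝ) < numPlays h C := by exact_mod_cast Nat.pos_of_ne_zero hn
  refine (pow_le_pow_iff_left₀ (by norm_num)
    (mul_nonneg (by norm_num) confRad_nonneg) two_ne_zero).1 ?_
  rw [mul_pow, confRad, Real.sq_sqrt (by positivity), ← mul_div_assoc, le_div_iff₀ hn0]
  nlinarith

/-- All observables of the analysis are concentrated. -/
def Good (I : Instance env Xcand) (T : ℕ) (h : History m) : Prop :=
  ∀ i, (Observable.family I i).Concentrated T h

namespace Good

variable (hg : Good I T h)
include hg

/-- For a cell that has been chosen often, either coin comes up in a quarter of its rounds. -/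
lemma quarter_le (hC : C.Feasible Xcand) (hs : 32 * Real.log T ≤ numPlays h C) (b : Bool) :
    (numPlays h C : ℝ) / 4 ≤ (roundsAt h C b).length := by
  have h1 := hg 5 C
  have h2 : (Observable.coin I).sum h C = (roundsAt h C true).length - numPlays h C / 2 := by
    rw [Observable.coin, Observable.sum_ofBoth]
    have h3 : cellExpect env Xcand C (fun b _ => if b = true then 1 else 0) = 1 / 2 := by
      have := env.outcomeProb_sum (I.anchor_weaklyBounded hC true)
      simp [cellExpect, this]
    have h4 : ((roundsIn h C).map fun r => if r.coin = true then (1 : ℝ) else 0).sum =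
        (roundsAt h C true).length := by
      unfold roundsAt
      induction roundsIn h C with
      | nil => simp
      | cons r l ih => cases hb : r.coin <;> simp [hb, ih]; ring
    rw [h3, h4]
    ring
  have h1' : ((Observable.coin I).sum h C) ^ 2 ≤
      2 * (Observable.coin I).count h C * Real.log T := h1
  rw [h2, Observable.coin, Observable.count_ofBoth] at h1'
  have h5 : ((numPlays h C : ℕ) : ℝ) =
      (roundsAt h C true).length + (roundsAt h C false).length := by
    rw [← length_roundsAt_add]; push_cast; ring
  have h6 : ((roundsAt h C true).length - (numPlays h C : ℝ) / 2) ^ 2 ≤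
      ((numPlays h C : ℝ) / 4) ^ 2 := by
    have : (0 : ℝ) ≤ numPlays h C := Nat.cast_nonneg _
    nlinarith
  have h7 := abs_le_of_sq_le_sq' h6 (by positivity)
  cases b <;> linarith [h7.1, h7.2]

lemma abs_avgValue_sub_le (hT : 18 ≤ T) (hC : C.Feasible Xcand) (hn : numPlays h C ≠ 0)
    (hs : 32 * Real.log T ≤ numPlays h C) (b : Bool) :
    |avgValue env h C b - env.V (C.anchor Xcand b)| ≤ deviation T h C := by
  have hL := one_le_log hT
  refine abs_average_sub_le (by positivity) (hg.quarter_le hC hs b) ?_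
  have h1 : ((Observable.value I b).sum h C) ^ 2 ≤
      2 * (Observable.value I b).count h C * Real.log T := by
    cases b
    · exact hg 1 C
    · exact hg 0 C
  rwa [Observable.value, Observable.sum_ofCoin, Observable.count_ofCoin] at h1

lemma abs_average_minPay_sub_le (hT : 18 ≤ T) (hC : C.Feasible Xcand) (hn : numPlays h C ≠ 0)
    (hs : 32 * Real.log T ≤ numPlays h C) (b : Bool) :
    |average ((roundsAt h C b).map fun r => pay C.minCorner r.outcome) -
      env.expect (C.anchor Xcand b) (pay C.minCorner)| ≤ deviation T h C := by
  have hL := one_le_log hT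
  refine abs_average_sub_le (by positivity) (hg.quarter_le hC hs b) ?_
  have h1 : ((Observable.minPay I b).sum h C) ^ 2 ≤
      2 * (Observable.minPay I b).count h C * Real.log T := by
    cases b
    · exact hg 3 C
    · exact hg 2 C
  rwa [Observable.minPay, Observable.sum_ofCoin, Observable.count_ofCoin] at h1

lemma abs_avgPayment_true_sub_le (hT : 18 ≤ T) (hC : C.Feasible Xcand)
    (hc : C.Composite Xcand) (hn : numPlays h C ≠ 0) (hs : 32 * Real.log T ≤ numPlays h C) :
    |avgPayment Xcand h C true - env.P C.maxCorner| ≤ (1 + m * C.side) * deviation T h C := by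
  have hL := one_le_log hT
  have hpos : 0 < 1 + m * C.side := by have := hC.side_pos; positivity
  have h1 : ((Observable.maxPay I).sum h C) ^ 2 ≤
      2 * (Observable.maxPay I).count h C * Real.log T := hg 4 C
  rw [Observable.maxPay, Observable.sum_ofCoin, Observable.count_ofCoin] at h1
  have h2 := abs_average_sub_le (by positivity) (hg.quarter_le hC hs true) h1
  have hw := I.anchor_weaklyBounded hC true
  have h3 : env.expect (C.anchor Xcand true) (fun π => pay C.maxCorner π / (1 + m * C.side)) =
      env.P C.maxCorner / (1 + m * C.side) := by
    rw [Environment.P, env.expect_eq_sum hw]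
    rw [Cell.anchor_true hc] at hw ⊢
    rw [env.expect_eq_sum hw, Finset.sum_div]
    exact Finset.sum_congr rfl fun π _ => by ring
  rw [h3, average_map_div, ← sub_div, abs_div, abs_of_pos hpos, div_le_iff₀ hpos] at h2
  rw [avgPayment_eq, Cell.anchor_true hc, mul_comm]
  exact h2

lemma abs_avgUtility_sub_le (hT : 18 ≤ T) (hC : C.Feasible Xcand) (hn : numPlays h C ≠ 0) :
    |avgUtility env Xcand h C - env.cellUtility Xcand C| ≤
      C.utilityRange Xcand / 2 * deviation T h C := by
  have hL := one_le_log hT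
  have hn0 : (0 : ℝ) < numPlays h C := by exact_mod_cast Nat.pos_of_ne_zero hn
  have hR := hC.two_le_utilityRange
  set R := C.utilityRange Xcand with hRdef
  have h1 : ((Observable.utility I).sum h C) ^ 2 ≤
      2 * (Observable.utility I).count h C * Real.log T := hg 6 C
  rw [Observable.utility, Observable.sum_ofBoth, Observable.count_ofBoth, ← hRdef] at h1
  have h2 : cellExpect env Xcand C (fun b π =>
      (env.value π - pay (C.anchor Xcand b) π + (R - 1)) / R) =
      (env.cellUtility Xcand C + (R - 1)) / R := by
    have : cellExpect env Xcand C (fun b π =>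
        (env.value π - pay (C.anchor Xcand b) π + (R - 1)) / R) =
        R⁻¹ * cellExpect env Xcand C (fun b π =>
          (env.value π - pay (C.anchor Xcand b) π) + (R - 1)) := by
      rw [← cellExpect_const_mul]
      congr 1
      ext b π
      ring
    rw [this, cellExpect_add, I.cellExpect_const hC, I.cellUtility_eq_cellExpect hC]
    ring
  have h3 : ((roundsIn h C).map fun r =>
      (env.value r.outcome - pay (C.anchor Xcand r.coin) r.outcome + (R - 1)) / R).sum =
      numPlays h C * ((avgUtility env Xcand h C + (R - 1)) / R) := by
    rw [sum_map_div, mul_div_assoc', mul_add, mul_comm _ (avgUtility _ _ _ _), avgUtility_eq,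
      numPlays, average_map_mul_length]
    congr 1
    induction roundsIn h C with
    | nil => simp
    | cons r l ih =>
      simp only [List.map_cons, List.sum_cons, ih, List.length_cons]
      push_cast
      ring
  rw [h2, h3] at h1
  have hx : (numPlays h C : ℝ) * ((avgUtility env Xcand h C + (R - 1)) / R) -
      numPlays h C * ((env.cellUtility Xcand C + (R - 1)) / R) =
      numPlays h C * ((avgUtility env Xcand h C - env.cellUtility Xcand C) / R) := by ring
  rw [hx] at h1
  set x := avgUtility env Xcand h C - env.cellUtility Xcand C with hxdef
  have h4 : (x / R) ^ 2 ≤ 2 * Real.log T / numPlays h C := by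
    rw [le_div_iff₀ hn0]
    refine le_of_mul_le_mul_left ?_ hn0
    nlinarith
  have h5 : |2 * (x / R)| ≤ deviation T h C := by
    refine Real.abs_le_sqrt ?_
    rw [mul_pow]
    calc (2 : ℝ) ^ 2 * (x / R) ^ 2 ≤ 2 ^ 2 * (2 * Real.log T / numPlays h C) := by gcongr
      _ = _ := by ring
  have h6 : x = R / 2 * (2 * (x / R)) := by field_simp
  rw [h6, abs_mul, abs_of_pos (by linarith : 0 < R / 2)]
  exact mul_le_mul_of_nonneg_left h5 (by linarith)

end Good

end Statistics

/-! ### Consequences of concentration for a single cell -/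

section SingleCell

variable {m : ℕ} {Θ E : Type*} [MeasurableSpace Θ] {env : Environment m Θ E}
  {Xcand : Set (Contract m)} {I : Instance env Xcand} {c : ℝ} {T : ℕ} {h : History m} {C : Cell m}

lemma avgUtility_composite (hn : numPlays h C ≠ 0) : ∃ p q : ℝ, 0 ≤ p ∧ 0 ≤ q ∧ p + q = 1 ∧
    avgUtility env Xcand h C =
      p * (avgValue env h C true - avgPayment Xcand h C true) +
      q * (avgValue env h C false - avgPayment Xcand h C false) := by
  have hn0 : (0 : ℝ) < numPlays h C := by exact_mod_cast Nat.pos_of_ne_zero hn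
  have h5 : (roundsAt h C true).length + (roundsAt h C false).length =
      ((numPlays h C : ℕ) : ℝ) := by
    rw [← length_roundsAt_add]; push_cast; ring
  refine ⟨(roundsAt h C true).length / numPlays h C, (roundsAt h C false).length / numPlays h C,
    by positivity, by positivity, ?_, ?_⟩
  · rw [← add_div, h5, div_self hn0.ne']
  · have := avgUtility_mul (env := env) (Xcand := Xcand) (h := h) (C := C)
    field_simp
    linarith

namespace Good

variable (hg : Good I T h)
include hg

/-- The index of a composite cell is at least the utility of each candidate contract in it. The
payments at the maximal corner may be large, but they enter the index with a nonnegative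
coefficient and are bounded below by the payments that the minimal corner specifies for the same
outcomes. -/
lemma optimism_composite (hcc : 16 ≤ c) (hT : 18 ≤ T) (hC : C.Feasible Xcand)
    (hc : C.Composite Xcand) (hn : numPlays h C ≠ 0) {y : Contract m} (hy : y ∈ C.carrier) :
    env.U y ≤ avgUtility env Xcand h C + widthEstimate env Xcand h C + 5 * confRad c T h C := by
  obtain ⟨p, q, hp, hq, hpq, hU⟩ := avgUtility_composite (env := env) (Xcand := Xcand) hn
  have hUy := (I.U_mem hC hy).2
  have hUy1 := env.U_le_one (hC.carrier_subset hy)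
  have hVp := avgValue_mem (env := env) (h := h) (C := C) true
  have hVm := avgValue_mem (env := env) (h := h) (C := C) false
  have hPm := avgPayment_false_mem (h := h) I hC hc
  have hPp := avgPayment_true_mem (h := h) I hC hc
  have hW : avgUtility env Xcand h C + widthEstimate env Xcand h C =
      avgValue env h C true - avgPayment Xcand h C false +
        p * (avgValue env h C true - avgValue env h C false) +
        q * (avgPayment Xcand h C true - avgPayment Xcand h C false) := by
    rw [hU, widthEstimate]
    have : q = 1 - p := by linarith
    rw [this]
    ring
  rw [hW]
  -- In the first case the index minus `5 rad` is at least `-2`, which the confidence radius makes up.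
  rcases lt_or_ge (numPlays h C : ℝ) (32 * Real.log T) with hs | hs
  · have h1 := confRad_large (c := c) hcc hT hn hs
    nlinarith
  · have h1 := seven_mul_deviation_le (h := h) (C := C) hcc hT
    have hd := deviation_nonneg (T := T) (h := h) (C := C)
    have hdp := abs_le.1 (hg.abs_avgValue_sub_le hT hC hn hs true)
    have hdm := abs_le.1 (hg.abs_avgValue_sub_le hT hC hn hs false)
    have hap := abs_le.1 (hg.abs_average_minPay_sub_le hT hC hn hs true)
    have ham := abs_le.1 (hg.abs_average_minPay_sub_le hT hC hn hs false)
    have hwm := I.anchor_weaklyBounded hC false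
    have hwp := I.anchor_weaklyBounded hC true
    rw [Cell.anchor_true hc] at hdp hap hwp
    rw [Cell.anchor_false hc] at hdm ham hwm
    have hle : ∀ i, C.minCorner i ≤ C.maxCorner i := fun i =>
      (Cell.maxCorner_mem hC.side_pos.le i).1
    have hV := env.V_mono I.fosd I.ties hwm hwp hle
    have hP := env.P_le_expect_pay I.fosd I.ties hwm hwp hle
    have hPA : average ((roundsAt h C true).map fun r => pay C.minCorner r.outcome) ≤
        avgPayment Xcand h C true := by
      rw [avgPayment_eq, Cell.anchor_true hc]
      exact average_map_mono fun r _ => pay_mono_left hle _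
    have hPm' : avgPayment Xcand h C false =
        average ((roundsAt h C false).map fun r => pay C.minCorner r.outcome) := by
      rw [avgPayment_eq, Cell.anchor_false hc]
    rw [← hPm'] at ham
    change _ ≤ avgPayment Xcand h C false - env.P C.minCorner ∧
      avgPayment Xcand h C false - env.P C.minCorner ≤ _ at ham
    have h2 : -(2 * deviation T h C) ≤ avgValue env h C true - avgValue env h C false := by
      linarith [hdp.1, hdm.2]
    have h3 : -(2 * deviation T h C) ≤
        avgPayment Xcand h C true - avgPayment Xcand h C false := by
      linarith [hap.1, ham.2]
    have h4 := mul_le_mul_of_nonneg_left h2 hp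
    have h5 := mul_le_mul_of_nonneg_left h3 hq
    have h6 : p * -(2 * deviation T h C) + q * -(2 * deviation T h C) =
        -(2 * deviation T h C) := by rw [← add_mul, hpq, one_mul]
    linarith [hdp.1, ham.2]

/-- The index of an atomic cell is at least the utility of its candidate contract. -/
lemma optimism_atomic (hcc : 16 ≤ c) (hT : 18 ≤ T) (hC : C.Feasible Xcand)
    (hc : ¬ C.Composite Xcand) (hn : numPlays h C ≠ 0) {y : Contract m}
    (hy : y ∈ C.carrier ∩ Xcand) :
    env.U y ≤ avgUtility env Xcand h C + confRad c T h C := by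
  have h1 := abs_le.1 (hg.abs_avgUtility_sub_le hT hC hn)
  have h2 : env.cellUtility Xcand C = env.U y := by
    simp only [Environment.cellUtility, Cell.anchor_atomic hc hy, Fintype.sum_bool]
    ring
  rw [h2, Cell.utilityRange, if_neg hc] at h1
  have h3 := seven_mul_deviation_le (h := h) (C := C) hcc hT
  have hd := deviation_nonneg (T := T) (h := h) (C := C)
  linarith [h1.1]

lemma index_ge (hcc : 16 ≤ c) (hT : 18 ≤ T) (hC : C.Feasible Xcand) {y : Contract m}
    (hy : y ∈ C.carrier ∩ Xcand) : (env.U y : EReal) ≤ index env Xcand c T h C := by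
  unfold index
  split_ifs with h1 h2
  · exact le_top
  · exact EReal.coe_le_coe_iff.2 (hg.optimism_composite hcc hT hC h2 h1 hy.1)
  · exact EReal.coe_le_coe_iff.2 (hg.optimism_atomic hcc hT hC h2 h1 hy)

/-- The width estimate of a cell with bounded payments deviates little from the virtual width. -/
lemma abs_widthEstimate_sub_le (hT : 18 ≤ T) (hC : C.Feasible Xcand)
    (hc : C.Composite Xcand) (hsmall : m * C.side ≤ 1) (hn : numPlays h C ≠ 0)
    (hs : 32 * Real.log T ≤ numPlays h C) :
    |widthEstimate env Xcand h C - env.virtualWidth C| ≤ 5 * deviation T h C := by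
  have hd := deviation_nonneg (T := T) (h := h) (C := C)
  have hdp := abs_le.1 (hg.abs_avgValue_sub_le hT hC hn hs true)
  have hdm := abs_le.1 (hg.abs_avgValue_sub_le hT hC hn hs false)
  have ham := abs_le.1 (hg.abs_average_minPay_sub_le hT hC hn hs false)
  have hpp := abs_le.1 (hg.abs_avgPayment_true_sub_le hT hC hc hn hs)
  have hPm' : avgPayment Xcand h C false =
      average ((roundsAt h C false).map fun r => pay C.minCorner r.outcome) := by
    rw [avgPayment_eq, Cell.anchor_false hc]
  rw [← hPm', Cell.anchor_false hc] at ham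
  change _ ≤ avgPayment Xcand h C false - env.P C.minCorner ∧
    avgPayment Xcand h C false - env.P C.minCorner ≤ _ at ham
  rw [Cell.anchor_true hc] at hdp
  rw [Cell.anchor_false hc] at hdm
  have h1 : (1 + m * C.side) * deviation T h C ≤ 2 * deviation T h C :=
    mul_le_mul_of_nonneg_right (by linarith) hd
  rw [abs_le]
  unfold widthEstimate Environment.virtualWidth
  constructor <;> linarith [hdp.1, hdp.2, hdm.1, hdm.2, ham.1, ham.2, hpp.1, hpp.2]

/-- A cell with bounded payments is only split once its virtual width is at least its confidence
radius. -/
lemma confRad_le_virtualWidth (hcc : 16 ≤ c) (hT : 18 ≤ T) (hC : C.Feasible Xcand)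
    (hc : C.Composite Xcand) (hsmall : m * C.side ≤ 1) (hn : numPlays h C ≠ 0)
    (hsplit : 5 * confRad c T h C < widthEstimate env Xcand h C) :
    confRad c T h C ≤ env.virtualWidth C ∧ 32 * Real.log T ≤ numPlays h C := by
  have hs : 32 * Real.log T ≤ numPlays h C := by
    by_contra hs
    have h1 := confRad_large (c := c) hcc hT hn (not_le.1 hs)
    have hVp := avgValue_mem (env := env) (h := h) (C := C) true
    have hVm := avgValue_mem (env := env) (h := h) (C := C) false
    have hPm := avgPayment_false_mem (h := h) I hC hc
    have hPp := avgPayment_true_mem (h := h) I hC hc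
    unfold widthEstimate at hsplit
    linarith [hVp.2, hVm.1, hPm.1, hPp.2]
  refine ⟨?_, hs⟩
  have h1 := seven_mul_deviation_le (h := h) (C := C) hcc hT
  have h2 := abs_le.1 (hg.abs_widthEstimate_sub_le hT hC hc hsmall hn hs)
  have := confRad_nonneg (c := c) (T := T) (h := h) (C := C)
  linarith [h2.2]

/-- A cell with bounded payments and a small width estimate has a small virtual width. -/
lemma virtualWidth_le (hcc : 16 ≤ c) (hT : 18 ≤ T) (hC : C.Feasible Xcand)
    (hc : C.Composite Xcand) (hsmall : m * C.side ≤ 1) (hn : numPlays h C ≠ 0) :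
    env.virtualWidth C ≤ widthEstimate env Xcand h C + 10 * confRad c T h C := by
  rcases lt_or_ge (numPlays h C : ℝ) (32 * Real.log T) with hs | hs
  · have h1 := confRad_large (c := c) hcc hT hn hs
    have hVp := avgValue_mem (env := env) (h := h) (C := C) true
    have hVm := avgValue_mem (env := env) (h := h) (C := C) false
    have hPm := avgPayment_false_mem (h := h) I hC hc
    have hPp := avgPayment_true_mem (h := h) I hC hc
    have hwm := hC.carrier_subset (Cell.minCorner_mem hC.side_pos.le)
    have hwp := hC.carrier_subset (Cell.maxCorner_mem hC.side_pos.le)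
    have h2 := env.P_le hwp (I.pay_maxCorner_le hC)
    unfold widthEstimate Environment.virtualWidth
    linarith [hVp.1, hVm.2, hPm.2, hPp.1, (env.V_mem hwm).1, (env.V_mem hwp).2,
      env.P_nonneg hwm]
  · have h1 := seven_mul_deviation_le (h := h) (C := C) hcc hT
    have h2 := abs_le.1 (hg.abs_widthEstimate_sub_le hT hC hc hsmall hn hs)
    have h3 := confRad_nonneg (c := c) (T := T) (h := h) (C := C)
    linarith [h2.1]

/-- A chosen cell that has not been split is nearly optimal up to its confidence radius. -/
lemma badness_le (hcc : 16 ≤ c) (hT : 18 ≤ T) (hC : C.Feasible Xcand)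
    (hn : numPlays h C ≠ 0) {B : ℝ} (hidx : (B : EReal) ≤ index env Xcand c T h C)
    (hW : C.Composite Xcand → widthEstimate env Xcand h C ≤ 5 * confRad c T h C) :
    B - env.cellUtility Xcand C ≤
      (10 + C.utilityRange Xcand / 2) * confRad c T h C := by
  have h1 := (abs_le.1 (hg.abs_avgUtility_sub_le hT hC hn)).2
  have h2 := seven_mul_deviation_le (h := h) (C := C) hcc hT
  have h3 := confRad_nonneg (c := c) (T := T) (h := h) (C := C)
  have hR := hC.two_le_utilityRange
  have hd := deviation_nonneg (T := T) (h := h) (C := C)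
  have h4 : C.utilityRange Xcand / 2 * deviation T h C ≤
      C.utilityRange Xcand / 2 * confRad c T h C :=
    mul_le_mul_of_nonneg_left (by linarith) (by linarith)
  unfold index at hidx
  rw [if_neg hn] at hidx
  split_ifs at hidx with hc
  · have h5 := EReal.coe_le_coe_iff.1 hidx
    have h6 := hW hc
    linarith
  · have h5 := EReal.coe_le_coe_iff.1 hidx
    linarith

end Good

end SingleCell

/-! ### The dyadic grid -/

namespace Cell

variable {m : ℕ} {Xcand : Set (Contract m)}

/-- Cells of the dyadic grid: the side is `2⁻ᵏ` and the corners are integer multiples of it. -/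
def OnGrid (C : Cell m) : Prop :=
  ∃ k : ℕ, C.side = (1 / 2) ^ k ∧ ∀ i, ∃ z : ℤ, C.lo i = z * (1 / 2) ^ k

lemma OnGrid.quadrant {C : Cell m} (h : C.OnGrid) (s : Fin m → Bool) : (C.quadrant s).OnGrid := by
  obtain ⟨k, hk, hz⟩ := h
  refine ⟨k + 1, by rw [quadrant_side, hk]; ring, fun i => ?_⟩
  obtain ⟨z, hz⟩ := hz i
  refine ⟨2 * z + if s i then 1 else 0, ?_⟩
  simp only [Cell.quadrant, hz, hk]
  split_ifs <;> push_cast <;> ring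

lemma Feasible.onGrid {C : Cell m} (h : C.Feasible Xcand) : C.OnGrid := by
  induction h with
  | root => exact ⟨0, by simp [Cell.root], fun i => ⟨0, by simp [Cell.root]⟩⟩
  | quadrant C Q _ hQ ih =>
    obtain ⟨⟨s, rfl⟩, _⟩ := hQ
    exact ih.quadrant s

/-- A grid cell is a quadrant of at most one grid cell. -/
lemma OnGrid.parent_unique {A B : Cell m} (hA : A.OnGrid) (hB : B.OnGrid) {s t : Fin m → Bool}
    (h : A.quadrant s = B.quadrant t) : A = B := by
  obtain ⟨k, hk, hzA⟩ := hA
  obtain ⟨l, hl, hzB⟩ := hB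
  have hside : A.side = B.side := by
    have := congrArg Cell.side h
    rw [quadrant_side, quadrant_side] at this
    linarith
  have hkl : k = l := by
    rw [hk, hl] at hside
    exact pow_right_injective₀ (by norm_num) (by norm_num) hside
  subst hkl
  ext i
  · obtain ⟨z, hz⟩ := hzA i
    obtain ⟨w, hw⟩ := hzB i
    have h1 := congrFun (congrArg Cell.lo h) i
    simp only [Cell.quadrant, hz, hw, hk, hl] at h1
    have hp : (0 : ℝ) < (1 / 2) ^ k := by positivity
    have h2 : (2 * z + (if s i then 1 else 0) : ℤ) = 2 * w + if t i then 1 else 0 := by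
      have : ((2 * z + (if s i then 1 else 0) : ℤ) : ℝ) = (2 * w + if t i then 1 else 0 : ℤ) := by
        push_cast
        refine mul_right_cancel₀ (b := (1 / 2 : ℝ) ^ k / 2) (by positivity) ?_
        split_ifs at h1 ⊢ <;> linarith
      exact_mod_cast this
    have : z = w := by split_ifs at h2 <;> omega
    rw [hz, hw, this]
  · exact hside

/-- A proper ancestor of a cell: the cell arises from it by one or more halvings. -/
def Ancestor : Cell m → Cell m → Prop :=
  Relation.TransGen fun A D => A.OnGrid ∧ ∃ s, D = A.quadrant s

lemma OnGrid.side_pos {A : Cell m} (hA : A.OnGrid) : 0 < A.side := by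
  obtain ⟨k, hk, _⟩ := hA
  rw [hk]; positivity

lemma Ancestor.side_lt {A D : Cell m} (h : Ancestor A D) : D.side < A.side := by
  induction h with
  | single h =>
    obtain ⟨hA, s, rfl⟩ := h
    rw [quadrant_side]; linarith [hA.side_pos]
  | tail _ h ih =>
    obtain ⟨hA, s, rfl⟩ := h
    rw [quadrant_side]; linarith [hA.side_pos]

lemma OnGrid.ancestor_quadrant {C : Cell m} (hC : C.OnGrid) (s : Fin m → Bool) :
    Ancestor C (C.quadrant s) :=
  Relation.TransGen.single ⟨hC, s, rfl⟩

lemma OnGrid.ancestor_of_quadrant {A C : Cell m} (hC : C.OnGrid) {s : Fin m → Bool}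
    (h : Ancestor A (C.quadrant s)) : A = C ∨ Ancestor A C := by
  rcases Relation.TransGen.tail'_iff.1 h with ⟨B, hAB, hB, t, ht⟩
  rw [hC.parent_unique hB ht]
  rcases Relation.reflTransGen_iff_eq_or_transGen.1 hAB with h | h
  · exact Or.inl h.symm
  · exact Or.inr h

end Cell

/-! ### Invariants of the algorithm -/

section Dynamics

variable {m : ℕ} {Θ E : Type*} [MeasurableSpace Θ] {env : Environment m Θ E}
  {Xcand : Set (Contract m)} {c : ℝ} {T : ℕ} {sel : History m → Cell m} {h : History m}
  {C Q : Cell m}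

lemma mem_active_cons {r : Round m} : C ∈ active env Xcand c T (r :: h) →
    C ∈ active env Xcand c T h ∧ (C = r.cell → C.Composite Xcand →
      widthEstimate env Xcand (r :: h) C ≤ 5 * confRad c T (r :: h) C) ∨
    C ∈ r.cell.relevantQuadrants Xcand ∧ C ≠ r.cell ∧ r.cell.Composite Xcand ∧
      5 * confRad c T (r :: h) r.cell < widthEstimate env Xcand (r :: h) r.cell := by
  intro hC
  simp only [active] at hC
  split_ifs at hC with hs
  · rcases hC.1 with h1 | h1
    · exact Or.inl ⟨h1, fun h2 => absurd h2 hC.2⟩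
    · exact Or.inr ⟨h1, hC.2, hs⟩
  · refine Or.inl ⟨hC, ?_⟩
    rintro rfl hc
    by_contra hlt
    exact hs ⟨hc, not_le.1 hlt⟩

lemma IsSelectionRule.feasible_of_active (hsel : IsSelectionRule env Xcand c T sel)
    (hr : Reach sel h) : ∀ C ∈ active env Xcand c T h, C.Feasible Xcand := by
  induction hr with
  | nil => rintro C rfl; exact .root
  | cons h b π hr ih =>
    intro C hC
    rcases mem_active_cons hC with ⟨h1, _⟩ | ⟨h1, _⟩
    · exact ih C h1
    · exact .quadrant _ C (ih _ (hsel h).1) h1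

lemma IsSelectionRule.feasible (hsel : IsSelectionRule env Xcand c T sel) (h : History m)
    (hr : Reach sel h) : (sel h).Feasible Xcand :=
  hsel.feasible_of_active hr _ (hsel h).1

/-- The active cells cover the candidate contracts. -/
lemma IsSelectionRule.exists_active (hsel : IsSelectionRule env Xcand c T sel)
    (hX : Xcand ⊆ boundedContracts m) (hr : Reach sel h) {y : Contract m} (hy : y ∈ Xcand) :
    ∃ C ∈ active env Xcand c T h, y ∈ C.carrier := by
  induction hr with
  | nil => exact ⟨_, rfl, Cell.mem_carrier_root.2 (boundedContracts_subset (hX hy))⟩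
  | cons h b π hr ih =>
    obtain ⟨C, hC, hyC⟩ := ih
    simp only [active]
    split_ifs with hs
    · by_cases hCs : C = sel h
      · subst hCs
        obtain ⟨s, hs'⟩ := Cell.exists_quadrant_mem hyC
        refine ⟨(sel h).quadrant s, ⟨Or.inr ⟨⟨s, rfl⟩, ⟨y, hs', hy⟩⟩, fun h1 => ?_⟩, hs'⟩
        have h2 := congrArg Cell.side (Set.mem_singleton_iff.1 h1)
        rw [Cell.quadrant_side] at h2
        have := (hsel.feasible h hr).side_pos
        linarith
      · exact ⟨C, ⟨Or.inl hC, hCs⟩, hyC⟩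
    · exact ⟨C, hC, hyC⟩

/-- No active cell is a proper ancestor of an active or a previously chosen cell. -/
lemma IsSelectionRule.not_ancestor (hsel : IsSelectionRule env Xcand c T sel)
    (hr : Reach sel h) : ∀ A ∈ active env Xcand c T h, ∀ D,
      D ∈ active env Xcand c T h ∨ D ∈ h.map Round.cell → ¬ Cell.Ancestor A D := by
  induction hr with
  | nil =>
    rintro A rfl D (rfl | hD) hAD
    · exact lt_irrefl _ hAD.side_lt
    · simp at hD
  | cons h b π hr ih =>
    have hQ := (hsel h).1
    have hg := (hsel.feasible h hr).onGrid
    intro A hA D hD hAD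
    have hD' : (D ∈ active env Xcand c T h ∨ D ∈ h.map Round.cell) ∨
        D ∈ (sel h).relevantQuadrants Xcand := by
      rcases hD with hD | hD
      · rcases mem_active_cons hD with ⟨h1, _⟩ | ⟨h1, _⟩
        · exact Or.inl (Or.inl h1)
        · exact Or.inr h1
      · rcases List.mem_cons.1 hD with rfl | hD
        · exact Or.inl (Or.inl hQ)
        · exact Or.inl (Or.inr hD)
    rcases mem_active_cons hA with ⟨hA1, -⟩ | ⟨hA1, -⟩
    · rcases hD' with hD' | ⟨⟨s, rfl⟩, hrel⟩
      · exact ih A hA1 D hD' hAD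
      · rcases hg.ancestor_of_quadrant hAD with rfl | h1
        · -- The quadrants of the chosen cell are new only if that cell has been split.
          rcases hD with hD | hD
          · rcases mem_active_cons hD with ⟨h1, _⟩ | ⟨_, _, hs⟩
            · exact ih _ hA1 _ (Or.inl h1) hAD
            · rcases mem_active_cons hA with ⟨_, h2⟩ | ⟨_, h2, _⟩
              · exact absurd hs.2 (not_lt.2 (h2 rfl hs.1))
              · exact h2 rfl
          · rcases List.mem_cons.1 hD with h1 | h1
            · have h2 := congrArg Cell.side h1
              rw [Cell.quadrant_side] at h2
              have := hg.side_pos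
              simp only at h2
              linarith
            · exact ih _ hA1 _ (Or.inr h1) hAD
        · exact ih A hA1 _ (Or.inl hQ) h1
    · obtain ⟨⟨s, rfl⟩, _⟩ := hA1
      rcases hD' with hD' | ⟨⟨t, rfl⟩, hrel⟩
      · exact ih _ hQ D hD' ((hg.ancestor_quadrant s).trans hAD)
      · exact lt_irrefl _ hAD.side_lt

lemma numPlays_eq_zero_iff : numPlays h C = 0 ↔ C ∉ h.map Round.cell := by
  rw [numPlays, roundsIn, List.length_eq_zero_iff, List.filter_eq_nil_iff]
  simp

lemma numPlays_cons_self (r : Round m) : numPlays (r :: h) r.cell = numPlays h r.cell + 1 := by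
  rw [numPlays, Observable.roundsIn_cons_self, List.length_cons, numPlays]

lemma confRad_cons_of_ne {r : Round m} (hC : C ≠ r.cell) :
    confRad c T (r :: h) C = confRad c T h C := by
  simp only [confRad, numPlays, Observable.roundsIn_cons_of_ne hC]

lemma widthEstimate_cons_of_ne {r : Round m} (hC : C ≠ r.cell) :
    widthEstimate env Xcand (r :: h) C = widthEstimate env Xcand h C := by
  simp only [widthEstimate, avgValue, avgPayment, roundsAt, Observable.roundsIn_cons_of_ne hC]

/-- An active composite cell that has been chosen before has a small width estimate. -/
lemma IsSelectionRule.widthEstimate_le (hsel : IsSelectionRule env Xcand c T sel)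
    (hr : Reach sel h) : ∀ C ∈ active env Xcand c T h, C.Composite Xcand → numPlays h C ≠ 0 →
      widthEstimate env Xcand h C ≤ 5 * confRad c T h C := by
  induction hr with
  | nil => intro C _ _ hn; simp [numPlays, roundsIn] at hn
  | cons h b π hr ih =>
    intro C hC hc hn
    by_cases hCs : C = sel h
    · rcases mem_active_cons hC with ⟨_, h1⟩ | ⟨_, h1, _⟩
      · exact h1 hCs hc
      · exact absurd hCs h1
    · have hne : C ≠ (⟨sel h, b, π⟩ : Round m).cell := hCs
      have hn' : numPlays h C ≠ 0 := by
        rwa [numPlays, Observable.roundsIn_cons_of_ne hne] at hn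
      rw [widthEstimate_cons_of_ne hne, confRad_cons_of_ne hne]
      rcases mem_active_cons hC with ⟨h1, _⟩ | ⟨⟨⟨s, rfl⟩, _⟩, _⟩
      · exact ih C h1 hc hn'
      · refine absurd ((hsel.feasible h hr).onGrid.ancestor_quadrant s)
          (hsel.not_ancestor hr _ (hsel h).1 _ (Or.inr ?_))
        by_contra h2
        exact hn' (numPlays_eq_zero_iff.2 h2)

section

variable {I : Instance env Xcand}

/-- The maximal index is at least the optimal utility. -/
lemma Good.opt_le_index (hg : Good I T h) (hcc : 16 ≤ c) (hT : 18 ≤ T)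
    (hsel : IsSelectionRule env Xcand c T sel) (hr : Reach sel h) :
    (env.opt Xcand : EReal) ≤ index env Xcand c T h (sel h) := by
  have h1 : ∀ y ∈ Xcand, (env.U y : EReal) ≤ index env Xcand c T h (sel h) := by
    intro y hy
    obtain ⟨C, hC, hyC⟩ := hsel.exists_active I.subset hr hy
    exact (hg.index_ge hcc hT (hsel.feasible_of_active hr C hC) ⟨hyC, hy⟩).trans
      ((hsel h).2 C hC)
  unfold index at h1 ⊢
  split_ifs at h1 ⊢
  · exact le_top
  · exact EReal.coe_le_coe_iff.2 (I.opt_le fun y hy => EReal.coe_le_coe_iff.1 (h1 y hy))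
  · exact EReal.coe_le_coe_iff.2 (I.opt_le fun y hy => EReal.coe_le_coe_iff.1 (h1 y hy))

lemma confRad_sq (hc : 0 ≤ c) (hT : 18 ≤ T) :
    confRad c T h C ^ 2 = c * Real.log T / numPlays h C := by
  have := one_le_log hT
  exact Real.sq_sqrt (by positivity)

/-- One more round changes the confidence radius by a factor of at most `√2`. -/
lemma confRad_sq_le (hc : 0 ≤ c) (hT : 18 ≤ T) (r : Round m) (hn : numPlays h r.cell ≠ 0) :
    confRad c T h r.cell ^ 2 ≤ 2 * confRad c T (r :: h) r.cell ^ 2 := by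
  have hL := one_le_log hT
  have hn1 : (1 : ℝ) ≤ numPlays h r.cell := by exact_mod_cast Nat.one_le_iff_ne_zero.2 hn
  rw [confRad_sq hc hT, confRad_sq hc hT, numPlays_cons_self, ← mul_div_assoc,
    div_le_div_iff₀ (by linarith) (by push_cast; linarith)]
  push_cast
  nlinarith [mul_nonneg hc (by linarith : 0 ≤ Real.log T)]

/-- The badness of a cell at the end of a round in which it has been chosen. -/
lemma Good.badness_le_of_chosen (hg : Good I T h) (hcc : 16 ≤ c) (hT : 18 ≤ T)
    (hsel : IsSelectionRule env Xcand c T sel) (hr : Reach sel h)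
    (hn : numPlays h (sel h) ≠ 0) : env.opt Xcand - env.cellUtility Xcand (sel h) ≤
      (10 + (sel h).utilityRange Xcand / 2) * confRad c T h (sel h) :=
  hg.badness_le hcc hT (hsel.feasible h hr) hn (hg.opt_le_index hcc hT hsel hr)
    fun hc => hsel.widthEstimate_le hr _ (hsel h).1 hc hn

/-- The origin of the chosen cells: each is the root or a quadrant of a composite cell which,
provided its payments are bounded, has a virtual width of at least `1/17` of its badness. -/
def HasParent (env : Environment m Θ E) (Xcand : Set (Contract m)) (C : Cell m) : Prop :=
  C = Cell.root m ∨ ∃ Q : Cell m, Q.Feasible Xcand ∧ Q.Composite Xcand ∧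
    (∃ s, C = Q.quadrant s) ∧
    (m * Q.side ≤ 1 → env.opt Xcand - env.cellUtility Xcand Q ≤ 17 * env.virtualWidth Q)

lemma IsSelectionRule.hasParent (hsel : IsSelectionRule env Xcand c T sel) (hcc : 16 ≤ c)
    (hT : 18 ≤ T) (hr : Reach sel h) (hg : AlongPath (Good I T) h) :
    ∀ C, C ∈ active env Xcand c T h ∨ C ∈ h.map Round.cell → HasParent env Xcand C := by
  induction hr with
  | nil =>
    rintro C (rfl | hC)
    · exact Or.inl rfl
    · simp at hC
  | cons h b π hr ih =>
    have ih := ih hg.2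
    rintro C (hC | hC)
    · rcases mem_active_cons hC with ⟨h1, _⟩ | ⟨⟨hs, _⟩, _, hc, hsplit⟩
      · exact ih C (Or.inl h1)
      · have hQ := hsel.feasible h hr
        refine Or.inr ⟨sel h, hQ, hc, hs, fun hsmall => ?_⟩
        set r : Round m := ⟨sel h, b, π⟩ with hrdef
        have hn1 : numPlays (r :: h) (sel h) = numPlays h (sel h) + 1 := numPlays_cons_self r
        obtain ⟨h2, h3⟩ := Good.confRad_le_virtualWidth hg.1 hcc hT hQ hc hsmall
          (by rw [hn1]; omega) hsplit
        have hn : numPlays h (sel h) ≠ 0 := by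
          intro h0
          rw [hn1, h0] at h3
          have := one_le_log hT
          norm_num at h3
          linarith
        have h4 := hg.2.self.badness_le_of_chosen hcc hT hsel hr hn
        have h5 : (sel h).utilityRange Xcand ≤ 3 := by
          rw [Cell.utilityRange, if_pos hc]; linarith
        have h6 := confRad_sq_le (c := c) (by linarith) hT r hn
        have h7 : 23 / 2 * confRad c T h (sel h) ≤ 17 * confRad c T (r :: h) (sel h) := by
          refine (pow_le_pow_iff_left₀ (mul_nonneg (by norm_num) confRad_nonneg)
            (mul_nonneg (by norm_num) confRad_nonneg) two_ne_zero).1 ?_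
          rw [mul_pow, mul_pow]
          change confRad c T h (sel h) ^ 2 ≤ 2 * confRad c T (r :: h) (sel h) ^ 2 at h6
          nlinarith [sq_nonneg (confRad c T (r :: h) (sel h))]
        have h8 : (10 + (sel h).utilityRange Xcand / 2) * confRad c T h (sel h) ≤
            23 / 2 * confRad c T h (sel h) :=
          mul_le_mul_of_nonneg_right (by linarith) confRad_nonneg
        change confRad c T (r :: h) (sel h) ≤ _ at h2
        linarith
    · rcases List.mem_cons.1 hC with rfl | hC
      · exact ih _ (Or.inl (hsel h).1)
      · exact ih C (Or.inr hC)

/-- Badness and virtual width of the chosen cells are bounded by the final confidence radius. -/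
lemma IsSelectionRule.chosen_bounds (hsel : IsSelectionRule env Xcand c T sel) (hcc : 16 ≤ c)
    (hT : 18 ≤ T) (hr : Reach sel h) (hg : AlongPath (Good I T) h) :
    ∀ C ∈ h.map Round.cell, C.Feasible Xcand ∧
      env.opt Xcand - env.cellUtility Xcand C ≤ (30 + 2 * m) * confRad c T h C ∧
      (C.Composite Xcand → m * C.side ≤ 1 → env.virtualWidth C ≤ 30 * confRad c T h C) := by
  induction hr with
  | nil => intro C hC; simp at hC
  | cons h b π hr ih =>
    have ih := ih hg.2
    intro C hC
    set r : Round m := ⟨sel h, b, π⟩ with hrdef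
    by_cases hCs : C = sel h
    · subst hCs
      have hQ := hsel.feasible h hr
      refine ⟨hQ, ?_⟩
      have hm : (0 : ℝ) ≤ m := Nat.cast_nonneg m
      have hrad := confRad_nonneg (c := c) (T := T) (h := r :: h) (C := sel h)
      have hL := one_le_log hT
      by_cases hn : numPlays h (sel h) = 0
      · have h1 : 1 ≤ confRad c T (r :: h) (sel h) := by
          rw [confRad, numPlays_cons_self r, hn, Real.one_le_sqrt]
          norm_num
          nlinarith
        constructor
        · have := I.cellUtility_ge hQ
          have := I.opt_le_one
          nlinarith
        · intro hc hsmall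
          have hwm := hQ.carrier_subset (Cell.minCorner_mem hQ.side_pos.le)
          have hwp := hQ.carrier_subset (Cell.maxCorner_mem hQ.side_pos.le)
          have h2 := env.P_le hwp (I.pay_maxCorner_le hQ)
          unfold Environment.virtualWidth
          linarith [(env.V_mem hwm).1, (env.V_mem hwp).2, env.P_nonneg hwm]
      · have h1 := hg.2.self.badness_le_of_chosen hcc hT hsel hr hn
        have h2 : confRad c T h (sel h) ≤ 2 * confRad c T (r :: h) (sel h) := by
          refine (pow_le_pow_iff_left₀ confRad_nonneg
            (mul_nonneg (by norm_num) confRad_nonneg) two_ne_zero).1 ?_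
          have h6 := confRad_sq_le (c := c) (by linarith) hT r hn
          change confRad c T h (sel h) ^ 2 ≤ 2 * confRad c T (r :: h) (sel h) ^ 2 at h6
          nlinarith [sq_nonneg (confRad c T (r :: h) (sel h))]
        have h0 := confRad_nonneg (c := c) (T := T) (h := h) (C := sel h)
        constructor
        · have h3 := hQ.utilityRange_le
          have h4 : (10 + (sel h).utilityRange Xcand / 2) * confRad c T h (sel h) ≤
              (15 + m) * confRad c T h (sel h) :=
            mul_le_mul_of_nonneg_right (by linarith) h0
          nlinarith
        · intro hc hsmall
          have h3 := hg.2.self.virtualWidth_le (c := c) hcc hT hQ hc hsmall hn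
          have h4 := hsel.widthEstimate_le hr _ (hsel h).1 hc hn
          linarith
    · have hne : C ≠ r.cell := hCs
      rw [confRad_cons_of_ne hne]
      rcases List.mem_cons.1 hC with h1 | h1
      · exact absurd h1 hCs
      · exact ih C h1

end

end Dynamics

/-! ### Charging the chosen cells -/

/-- If each `a ∈ S` is charged to an element `φ a` of the set `A (j a)`, and at most `b` elements
are charged to the same element, then the total charge is at most `b` times the total weight. -/
lemma sum_le_of_charging {α β ι : Type*} [DecidableEq α] [DecidableEq β] [DecidableEq ι]
    (S : Finset α) (j : α → ι) (φ : α → β)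
    (A : ι → Set β) (g : ι → ℝ≥0∞) (b : ℕ) (fib : β → Finset α) (hb : ∀ q, (fib q).card ≤ b)
    (hA : ∀ a ∈ S, φ a ∈ A (j a)) (hfib : ∀ a ∈ S, a ∈ fib (φ a)) :
    ∑ a ∈ S, g (j a) ≤ b * ∑' i, ((A i).encard : ℝ≥0∞) * g i := by
  rw [← ENNReal.tsum_mul_left,
    ← Finset.sum_fiberwise_of_maps_to (fun a ha => Finset.mem_image_of_mem j ha)]
  refine le_trans (Finset.sum_le_sum fun i _ => ?_) (ENNReal.sum_le_tsum (S.image j))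
  set F := S.filter fun a => j a = i with hF
  have h1 : ∑ a ∈ F, g (j a) = F.card * g i := by
    rw [Finset.sum_congr rfl fun a ha => by rw [(Finset.mem_filter.1 ha).2], Finset.sum_const,
      nsmul_eq_mul]
  have h2 : F.card ≤ b * (F.image φ).card := by
    refine Finset.card_le_mul_card_image _ _ fun q _ => (Finset.card_le_card ?_).trans (hb q)
    intro a ha
    obtain ⟨ha1, rfl⟩ := Finset.mem_filter.1 ha
    exact hfib a (Finset.mem_filter.1 ha1).1
  have h3 : ((F.image φ).card : ℝ≥0∞) ≤ ((A i).encard : ℝ≥0∞) := by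
    have : ((F.image φ).card : ℕ∞) ≤ (A i).encard := by
      rw [← Set.encard_coe_eq_coe_finsetCard]
      refine Set.encard_le_encard fun q hq => ?_
      obtain ⟨a, ha, rfl⟩ := Finset.mem_image.1 (Finset.mem_coe.1 hq)
      obtain ⟨ha1, rfl⟩ := Finset.mem_filter.1 ha
      exact hA a ha1
    exact_mod_cast ENat.toENNReal_le.2 this
  rw [h1, ← mul_assoc]
  refine mul_le_mul_left (le_trans ?_ (mul_le_mul_right h3 _)) _
  exact_mod_cast h2

lemma exists_dyadic_scale {e : ℝ} (he : 0 < e) :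
    ∃ j : ℤ, e ≤ (2 : ℝ) ^ (-j) ∧ (2 : ℝ) ^ (-j) ≤ 2 * e := by
  obtain ⟨n, hn⟩ := exists_mem_Ioc_zpow he (one_lt_two)
  refine ⟨-(n + 1), by simpa using hn.2, ?_⟩
  rw [neg_neg, zpow_add_one₀ two_ne_zero]
  linarith [hn.1]

section Charging

variable {m : ℕ} {Θ E : Type*} [MeasurableSpace Θ] {env : Environment m Θ E}
  {Xcand : Set (Contract m)} {c : ℝ} {T : ℕ} {h : History m} {C Q : Cell m}

/-- The sum over rounds, grouped by cells. -/
lemma sum_map_cell [DecidableEq (Cell m)] (f : Cell m → ℝ) (h : History m) :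
    (h.map fun r => f r.cell).sum =
      ∑ C ∈ (h.map Round.cell).toFinset, (numPlays h C : ℝ) * f C := by
  have h1 := Finset.sum_list_map_count (h.map Round.cell) f
  rw [List.map_map] at h1
  refine h1.trans (Finset.sum_congr rfl fun C _ => ?_)
  rw [nsmul_eq_mul]
  congr 2
  rw [List.count, List.countP_map, List.countP_eq_length_filter, numPlays, roundsIn]
  congr 1
  refine List.filter_congr fun r _ => ?_
  by_cases hC : r.cell = C <;> simp [hC]

/-- The cells obtained by at most `m` halvings of the root. They include all quadrants of cells whose
payments may exceed `2`, and their number depends only on `m`. -/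
noncomputable def coarseCells (m : ℕ) : Finset (Cell m) :=
  open Classical in (Finset.range (m + 1)).biUnion (Cell.dyadic m)

lemma Cell.Feasible.small_of_notMem (hQ : Q.Feasible Xcand) {s : Fin m → Bool}
    (hC : Q.quadrant s ∉ coarseCells m) : m * Q.side ≤ 1 := by
  classical
  obtain ⟨k, hk, hs⟩ := hQ.exists_dyadic
  have hkm : m ≤ k := by
    by_contra hlt
    refine hC (Finset.mem_biUnion.2 ⟨k + 1, ?_, Cell.quadrant_mem_dyadic hk s⟩)
    rw [Finset.mem_range]
    omega
  have h1 : (m : ℝ) ≤ 2 ^ k := by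
    have : m ≤ 2 ^ k := (Nat.lt_two_pow_self).le.trans (Nat.pow_le_pow_right two_pos hkm)
    exact_mod_cast this
  rw [hs, one_div, inv_pow, ← div_eq_mul_inv, div_le_one (by positivity)]
  exact h1

/-- The cells counted by `N_{εβ₀}(X_ε | X_cand)` for `β₀ = 1/36`. -/
def countedCells (env : Environment m Θ E) (Xcand : Set (Contract m)) (ε : ℝ) : Set (Cell m) :=
  {C | C.Feasible Xcand ∧ C.Composite Xcand ∧ ε * (1 / 36) ≤ env.virtualWidth C ∧
    (C.carrier ∩ env.nearOptimal Xcand ε).Nonempty}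

lemma Instance.root_mem_countedCells (I : Instance env Xcand)
    (hroot : (Cell.root m).Composite Xcand) {ε : ℝ} (hε : 0 < ε)
    (hw : ε ≤ 2 * env.virtualWidth (Cell.root m)) :
    Cell.root m ∈ countedCells env Xcand ε := by
  obtain ⟨y, hy⟩ := I.nearOptimal_nonempty hε
  exact ⟨.root, hroot, by linarith, y,
    Cell.mem_carrier_root.2 (boundedContracts_subset (I.subset hy.1)), hy⟩

/-- The rounds in a cell of badness `d ≤ e` with `e` at most a multiple of the confidence radius cost
`O(log T / e)` in total, since the confidence radius bounds their number by `O(log T / e²)`. -/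
lemma numPlays_mul_le (hc : 0 ≤ c) (hT : 18 ≤ T) {κ e d ε : ℝ} (he : 0 < e)
    (hde : d ≤ e) (hκ : e ≤ κ * confRad c T h C) (hε0 : 0 < ε) (hε : ε ≤ 2 * e)
    (hn : numPlays h C ≠ 0) :
    numPlays h C * d ≤ 2 * κ ^ 2 * c * Real.log T / ε := by
  have hn0 : (0 : ℝ) < numPlays h C := by exact_mod_cast Nat.pos_of_ne_zero hn
  have hL := one_le_log hT
  have h1 : e ^ 2 ≤ κ ^ 2 * (c * Real.log T / numPlays h C) := by
    rw [← confRad_sq hc hT, ← mul_pow]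
    exact pow_le_pow_left₀ he.le hκ 2
  have h2 : numPlays h C * e ^ 2 ≤ κ ^ 2 * (c * Real.log T) := by
    rw [← mul_div_assoc, le_div_iff₀ hn0] at h1
    linarith
  rw [le_div_iff₀ hε0]
  have h3 : numPlays h C * d * ε ≤ numPlays h C * e * (2 * e) := by
    have h4 : (numPlays h C : ℝ) * d ≤ numPlays h C * e := mul_le_mul_of_nonneg_left hde hn0.le
    exact (mul_le_mul_of_nonneg_right h4 hε0.le).trans
      (mul_le_mul_of_nonneg_left hε (by positivity))
  nlinarith

/-- The charging rule. Coarse cells are charged to the root, at the dyadic scale of their badness. All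
other cells are charged to their parent, at the dyadic scale of the larger one of the badness of the
cell and the badness of a candidate contract in it. -/
lemma exists_charge (I : Instance env Xcand) (hcc : 16 ≤ c) (hT : 18 ≤ T)
    (hC : C.Feasible Xcand) (hn : numPlays h C ≠ 0)
    (hbad : env.opt Xcand - env.cellUtility Xcand C ≤ (30 + 2 * m) * confRad c T h C)
    (hvw : C.Composite Xcand → m * C.side ≤ 1 → env.virtualWidth C ≤ 30 * confRad c T h C)
    (hpar : HasParent env Xcand C) {δ : ℝ} (hδ : 0 < δ)
    (hlarge : δ < env.opt Xcand - env.cellUtility Xcand C) :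
    ∃ j : ℤ, ∃ Q : Cell m, δ ≤ (2 : ℝ) ^ (-j) ∧ Q ∈ countedCells env Xcand ((2 : ℝ) ^ (-j)) ∧
      (C ∈ coarseCells m ∨ ∃ s, C = Q.quadrant s) ∧
      numPlays h C * (env.opt Xcand - env.cellUtility Xcand C) ≤
        2 * (60 + 2 * m) ^ 2 * c * Real.log T / (2 : ℝ) ^ (-j) := by
  classical
  have hrad := confRad_nonneg (c := c) (T := T) (h := h) (C := C)
  have hm : (0 : ℝ) ≤ m := Nat.cast_nonneg m
  set d := env.opt Xcand - env.cellUtility Xcand C with hd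
  have hd0 : 0 < d := hδ.trans hlarge
  have hc0 : 0 ≤ c := by linarith
  by_cases hcoarse : C ∈ coarseCells m
  · have hroot : (Cell.root m).Composite Xcand := by
      by_contra hr
      rw [hd, I.cellUtility_of_root_atomic hr hC, sub_self] at hd0
      exact lt_irrefl _ hd0
    obtain ⟨j, hj1, hj2⟩ := exists_dyadic_scale hd0
    have hpos : (0 : ℝ) < 2 ^ (-j) := by positivity
    refine ⟨j, Cell.root m, hlarge.le.trans hj1, I.root_mem_countedCells hroot hpos ?_,
      Or.inl hcoarse, numPlays_mul_le hc0 hT hd0 le_rfl ?_ hpos hj2 hn⟩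
    · linarith [I.badness_le_root hC]
    · nlinarith
  · rcases hpar with rfl | ⟨Q, hQ, hQc, ⟨s, rfl⟩, hQw⟩
    · refine absurd (Finset.mem_biUnion.2 ⟨0, by simp, ?_⟩) hcoarse
      simp [Cell.dyadic]
    have hsmall := hQ.small_of_notMem hcoarse
    have hsmall' : m * (Q.quadrant s).side ≤ 1 := by
      rw [Cell.quadrant_side]
      have : 0 ≤ m * Q.side := mul_nonneg hm hQ.side_pos.le
      linarith
    have hQw := hQw hsmall
    have hsub := Cell.quadrant_carrier_subset hQ.side_pos.le s
    obtain ⟨y, hy⟩ := hC.relevant I.subset I.nonempty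
    have hybad : env.opt Xcand - env.U y ≤ (60 + 2 * m) * confRad c T h (Q.quadrant s) := by
      by_cases hcomp : (Q.quadrant s).Composite Xcand
      · have h1 := hvw hcomp hsmall'
        have h2 := (I.U_mem hC hy.1).1
        have h3 := (I.cellUtility_mem hC hC subset_rfl).2
        unfold Environment.virtualWidth at h1
        linarith
      · have : env.cellUtility Xcand (Q.quadrant s) = env.U y := by
          simp only [Environment.cellUtility, Cell.anchor_atomic hcomp hy, Fintype.sum_bool]
          ring
        rw [← this]
        linarith
    have hlow : env.opt Xcand - (env.V Q.minCorner - env.P Q.maxCorner) ≤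
        18 * env.virtualWidth Q := by
      have h1 := (I.cellUtility_mem hQ hQ subset_rfl).2
      unfold Environment.virtualWidth at *
      linarith
    have hy18 : env.opt Xcand - env.U y ≤ 18 * env.virtualWidth Q := by
      linarith [(I.U_mem hQ (hsub hy.1)).1]
    have hd18 : d ≤ 18 * env.virtualWidth Q := by
      linarith [(I.cellUtility_mem hQ hC hsub).1]
    set e := max d (env.opt Xcand - env.U y) with he
    have hde : d ≤ e := le_max_left _ _
    have hye : env.opt Xcand - env.U y ≤ e := le_max_right _ _
    have he0 : 0 < e := hd0.trans_le hde
    obtain ⟨j, hj1, hj2⟩ := exists_dyadic_scale he0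
    have hpos : (0 : ℝ) < 2 ^ (-j) := by positivity
    refine ⟨j, Q, (hlarge.le.trans hde).trans hj1, ⟨hQ, hQc, ?_, y, hsub hy.1, hy.2, ?_⟩,
      Or.inr ⟨s, rfl⟩, numPlays_mul_le hc0 hT he0 hde ?_ hpos hj2 hn⟩
    · have : e ≤ 18 * env.virtualWidth Q := max_le hd18 hy18
      linarith
    · linarith
    · refine max_le ?_ hybad
      linarith

/-- The sum of `N_{εβ₀}(X_ε | X_cand) / ε` over the scales `ε = 2⁻ʲ ≥ δ`, for `β₀ = 1/36`. -/
noncomputable def chargeSum (env : Environment m Θ E) (Xcand : Set (Contract m)) (δ : ℝ) : ℝ≥0∞ :=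
  ∑' j : {j : ℤ // δ ≤ (2 : ℝ) ^ (-j)},
    ((countedCells env Xcand ((2 : ℝ) ^ (-(j : ℤ)))).encard : ℝ≥0∞) *
      (ENNReal.ofReal ((2 : ℝ) ^ (-(j : ℤ))))⁻¹

/-- A bound on the number of cells that may be charged to the same cell: the coarse cells, and the
quadrants of that cell. -/
noncomputable def chargeMultiplicity (m : ℕ) : ℕ := (coarseCells m).card + 2 ^ m

/-- The bound on the badnesses of all rounds of a play in which the averages concentrate. -/
lemma sum_badness_le {I : Instance env Xcand} {sel : History m → Cell m} (hcc : 16 ≤ c)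
    (hT : 18 ≤ T) (hsel : IsSelectionRule env Xcand c T sel) (hr : Reach sel h)
    (hl : h.length = T) (hg : AlongPath (Good I T) h) {δ : ℝ} (hδ : 0 < δ) :
    ENNReal.ofReal (h.map fun r => env.opt Xcand - env.cellUtility Xcand r.cell).sum ≤
      ENNReal.ofReal (δ * T) +
        ENNReal.ofReal (2 * (60 + 2 * m) ^ 2 * c * Real.log T) *
          (chargeMultiplicity m * chargeSum env Xcand δ) := by
  classical
  set D : Cell m → ℝ := fun C => env.opt Xcand - env.cellUtility Xcand C with hD
  set cells := (h.map Round.cell).toFinset with hcells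
  set S := cells.filter fun C => δ < D C with hS
  have hL := one_le_log hT
  set K₀ := 2 * (60 + 2 * (m : ℝ)) ^ 2 * c * Real.log T with hK₀
  have hsplit : (h.map fun r => D r.cell).sum ≤ δ * T + ∑ C ∈ S, (numPlays h C : ℝ) * D C := by
    have h1 : ∑ C ∈ cells, (numPlays h C : ℝ) * δ = δ * T := by
      rw [← sum_map_cell (fun _ => δ) h]
      simp [hl, mul_comm]
    rw [sum_map_cell D h, ← h1, hS, Finset.sum_filter, ← Finset.sum_add_distrib]
    refine Finset.sum_le_sum fun C _ => ?_
    split_ifs with hlt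
    · have : (0 : ℝ) ≤ numPlays h C * δ := by positivity
      linarith
    · rw [add_zero]
      exact mul_le_mul_of_nonneg_left (not_lt.1 hlt) (Nat.cast_nonneg _)
  have hcharge : ∀ C ∈ S, ∃ j : {j : ℤ // δ ≤ (2 : ℝ) ^ (-j)}, ∃ Q : Cell m,
      Q ∈ countedCells env Xcand ((2 : ℝ) ^ (-(j : ℤ))) ∧
      (C ∈ coarseCells m ∨ ∃ s, C = Q.quadrant s) ∧
      numPlays h C * D C ≤ K₀ / (2 : ℝ) ^ (-(j : ℤ)) := by
    intro C hC
    obtain ⟨hC1, hC2⟩ := Finset.mem_filter.1 hC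
    have hmem := List.mem_toFinset.1 hC1
    obtain ⟨hf, hb, hv⟩ := hsel.chosen_bounds hcc hT hr hg C hmem
    obtain ⟨j, Q, hj, hrest⟩ := exists_charge I hcc hT hf
      (fun h0 => numPlays_eq_zero_iff.1 h0 hmem) hb hv
      (hsel.hasParent hcc hT hr hg C (Or.inr hmem)) hδ hC2
    exact ⟨⟨j, hj⟩, Q, hrest⟩
  have hne : Nonempty {j : ℤ // δ ≤ (2 : ℝ) ^ (-j)} := by
    obtain ⟨j, hj, _⟩ := exists_dyadic_scale hδ
    exact ⟨⟨j, hj⟩⟩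
  have hne' : Nonempty (Cell m) := ⟨Cell.root m⟩
  choose! j Q hQ hfib hle using hcharge
  have hsum := sum_le_of_charging S j Q
    (fun j => countedCells env Xcand ((2 : ℝ) ^ (-(j : ℤ))))
    (fun j => (ENNReal.ofReal ((2 : ℝ) ^ (-(j : ℤ))))⁻¹) (chargeMultiplicity m)
    (fun Q => coarseCells m ∪ Finset.univ.image Q.quadrant)
    (fun Q => (Finset.card_union_le _ _).trans
      (Nat.add_le_add_left (Finset.card_image_le.trans (by simp)) _))
    hQ (fun C hC => by
      rcases hfib C hC with h1 | ⟨s, h1⟩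
      · exact Finset.mem_union_left _ h1
      · exact Finset.mem_union_right _ (Finset.mem_image.2 ⟨s, Finset.mem_univ _, h1.symm⟩))
  have hDnn : ∀ C ∈ S, 0 ≤ (numPlays h C : ℝ) * D C := fun C hC =>
    mul_nonneg (Nat.cast_nonneg _) (hδ.le.trans (Finset.mem_filter.1 hC).2.le)
  calc ENNReal.ofReal (h.map fun r => D r.cell).sum
      ≤ ENNReal.ofReal (δ * T + ∑ C ∈ S, (numPlays h C : ℝ) * D C) :=
        ENNReal.ofReal_le_ofReal hsplit
    _ = ENNReal.ofReal (δ * T) + ∑ C ∈ S, ENNReal.ofReal ((numPlays h C : ℝ) * D C) := by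
        rw [ENNReal.ofReal_add (by positivity) (Finset.sum_nonneg hDnn),
          ENNReal.ofReal_sum_of_nonneg hDnn]
    _ ≤ ENNReal.ofReal (δ * T) + ∑ C ∈ S,
          ENNReal.ofReal K₀ * (ENNReal.ofReal ((2 : ℝ) ^ (-(j C : ℤ))))⁻¹ := by
        gcongr with C hC
        refine (ENNReal.ofReal_le_ofReal (hle C hC)).trans (le_of_eq ?_)
        rw [ENNReal.ofReal_div_of_pos (by positivity), div_eq_mul_inv]
    _ ≤ _ := by
        rw [← Finset.mul_sum]
        gcongr
        exact hsum

end Charging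

end ContractDesign

theorem theorem1 :
    ∃ β₀ : ℝ, 0 < β₀ ∧ ∀ (m : ℕ) (c : ℝ), 16 ≤ c → ∃ K : ℝ, 0 < K ∧
      ∀ (Θ : Type u) (E : Type v) [MeasurableSpace Θ] (env : Environment m Θ E),
        env.FOSD → env.ConsistentTieBreaking →
      ∀ Xcand : Set (Contract m), Xcand ⊆ boundedContracts m → Xcand.Nonempty →
      ∀ T : ℕ, max (2 ^ m + 1) 18 ≤ T →
      ∀ sel : History m → Cell m, IsSelectionRule env Xcand c T sel →
      ∀ δ : ℝ, 0 < δ →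
        ENNReal.ofReal (regret env Xcand T sel) ≤
          ENNReal.ofReal (δ * T) + ENNReal.ofReal (K * Real.log T) *
            ∑' j : {j : ℤ // δ ≤ (2 : ℝ) ^ (-j)},
              (env.cellCount Xcand ((2 : ℝ) ^ (-(j : ℤ)) * β₀)
                (env.nearOptimal Xcand ((2 : ℝ) ^ (-(j : ℤ)))) : ℝ≥0∞) /
                ENNReal.ofReal ((2 : ℝ) ^ (-(j : ℤ))) := by
  refine ⟨1 / 36, by norm_num, fun m c hcc => ?_⟩
  set K₁ : ℝ := 2 * (60 + 2 * m) ^ 2 * c * chargeMultiplicity m with hK₁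
  have hK₁0 : 0 ≤ K₁ := by positivity
  refine ⟨K₁ + 56 * (2 + m) ^ 2, by positivity, ?_⟩
  intro Θ E _ env hF hTB Xcand hX hne T hT2 sel hsel δ hδ
  have hT : 18 ≤ T := (le_max_right _ _).trans hT2
  have hL := one_le_log hT
  have I : Instance env Xcand := ⟨hF, hTB, hX, hne⟩
  change _ ≤ _ + _ * chargeSum env Xcand δ
  by_cases hsimple : ∀ C : Cell m, C.Feasible Xcand →
      env.opt Xcand - env.cellUtility Xcand C ≤ δ
  · -- All rounds have badness at most `δ`.
    refine le_add_right (ENNReal.ofReal_le_ofReal ?_)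
    have := regret_le_of_concentrated I hsel.feasible (T := T) (A := δ) (B := δ * T)
      (fun i : Fin 0 => i.elim0) (by omega) hδ.le (by positivity) hsimple
      (fun h hr hl _ => by
        have h1 : ∀ h, Reach sel h → (h.map fun r => env.opt Xcand -
            env.cellUtility Xcand r.cell).sum ≤ δ * h.length := by
          intro h hr
          induction hr with
          | nil => simp
          | cons h b π hr ih =>
            simp only [List.map_cons, List.sum_cons, List.length_cons]
            push_cast
            linarith [hsimple _ (hsel.feasible h hr)]
        have := h1 h hr
        rwa [hl] at this)
    simpa using this
  · -- The root is counted at the scale of its virtual width; this absorbs the regret incurred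
    -- when concentration fails.
    push Not at hsimple
    obtain ⟨C, hC, hCδ⟩ := hsimple
    have hroot : (Cell.root m).Composite Xcand := by
      by_contra hr
      rw [I.cellUtility_of_root_atomic hr hC, sub_self] at hCδ
      linarith
    have hwδ : δ < env.virtualWidth (Cell.root m) := hCδ.trans_le (I.badness_le_root hC)
    have hw := I.virtualWidth_root_le
    obtain ⟨j, hj1, hj2⟩ := exists_dyadic_scale (hδ.trans hwδ)
    have hjpos : (0 : ℝ) < 2 ^ (-j) := by positivity
    have hlow : (ENNReal.ofReal (2 * (2 + m)))⁻¹ ≤ chargeSum env Xcand δ := by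
      have h1 : (1 : ℝ≥0∞) ≤ ((countedCells env Xcand ((2 : ℝ) ^ (-j))).encard : ℝ≥0∞) := by
        have : (1 : ℕ∞) ≤ (countedCells env Xcand ((2 : ℝ) ^ (-j))).encard :=
          Set.one_le_encard_iff_nonempty.2 ⟨_, I.root_mem_countedCells hroot hjpos hj2⟩
        exact_mod_cast ENat.toENNReal_le.2 this
      refine le_trans ?_ (ENNReal.le_tsum (⟨j, hwδ.le.trans hj1⟩ : {j : ℤ // δ ≤ (2 : ℝ) ^ (-j)}))
      refine le_trans ?_ (mul_le_mul_left h1 _)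
      rw [one_mul]
      exact ENNReal.inv_le_inv.2 (ENNReal.ofReal_le_ofReal (by linarith))
    by_cases htop : chargeSum env Xcand δ = ⊤
    · rw [htop, ENNReal.mul_top]
      · simp
      · simp only [ne_eq, ENNReal.ofReal_eq_zero, not_le]
        positivity
    obtain ⟨s, hs0, hs⟩ : ∃ s : ℝ, 0 ≤ s ∧ chargeSum env Xcand δ = ENNReal.ofReal s :=
      ⟨_, ENNReal.toReal_nonneg, (ENNReal.ofReal_toReal htop).symm⟩
    have hlow' : 1 ≤ 2 * (2 + m) * s := by
      rw [hs, ← ENNReal.ofReal_inv_of_pos (by positivity), ENNReal.ofReal_le_ofReal_iff hs0,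
        inv_le_iff_one_le_mul₀ (by positivity)] at hlow
      linarith
    have hmain := regret_le_of_concentrated I hsel.feasible (T := T) (A := 2 + m)
      (B := δ * T + K₁ * Real.log T * s) (Observable.family I) (by omega) (by positivity)
      (by positivity) (fun C hC => (I.badness_le_root hC).trans hw)
      (fun h hr hl hg => by
        have h1 := sum_badness_le (I := I) hcc hT hsel hr hl hg hδ
        rw [hs, ← ENNReal.ofReal_natCast, ← ENNReal.ofReal_mul (by positivity),
          ← ENNReal.ofReal_mul (by positivity),
          ← ENNReal.ofReal_add (by positivity) (by positivity),
          ENNReal.ofReal_le_ofReal_iff (by positivity)] at h1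
        refine h1.trans (le_of_eq ?_)
        rw [hK₁]
        ring)
    rw [hs, ← ENNReal.ofReal_mul (by positivity),
      ← ENNReal.ofReal_add (by positivity) (by positivity)]
    refine ENNReal.ofReal_le_ofReal (hmain.trans ?_)
    rw [Fintype.card_fin]
    push_cast
    have h2 : (28 : ℝ) * (2 + m) ≤ 28 * (2 + m) * (2 * (2 + m) * s) :=
      le_mul_of_one_le_right (by positivity) hlow'
    have h3 : 56 * (2 + (m : ℝ)) ^ 2 * s ≤ 56 * (2 + m) ^ 2 * s * Real.log T :=
      le_mul_of_one_le_right (by positivity) hL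
    nlinarith
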